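/- All matroids have finite ground sets. For a finite point configuration $V\subset\mathbb{R}^n$, a face of $V$ is a set $\{v\in V:\ell(v)=0\}$ with $\ell$ an affine function that is non-negative on $V$; a facet is an inclusion-maximal face among those different from $V$, and such an $\ell$ is facet-defining if $\{v\in V:\ell(v)=0\}$ is a facet. The levelness of $V$ is the smallest $k$ such that every facet-defining affine function takes at most $k$ distinct values on $V$. The levelness $\mathrm{Lev}(M)$ of a matroid $M$ with ground set $E$ is the levelness of the set of characteristic vectors of its bases in $\mathbb{R}^E$. A matroid is called $k$-level, as a member of the class of $k$-level matroids, if $\mathrm{Lev}(M)\le k$, and minimally $k$-level if $\mathrm{Lev}(M)=k$ and $\mathrm{Lev}(N)<k$ for every proper minor $N$ of $M$. An excluded minor for a class of matroids is a matroid that is not in the class but all of whose proper minors are. Theorem. Let $k\ge 1$. (1) The excluded minors for the class of $(k-1)$-level matroids are exactly the minimally $k$-level matroids. (2) Up to isomorphism there are only finitely many of them; and a matroid is $(k-1)$-level if and only if it has no minor isomorphic to one of them. (3) Let $M$ be a minimally $k$-level matroid with ground set $E$. If $k\ge 4$, then $|E|\le 4k-8$; if moreover $\mathrm{rk}(M)=k$,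 then $|E|\le 3k-4$. If $k=3$, then $|E|\le 6$. -/

import Mathlib

universe u

namespace MatroidLevel

/-! ### Point configurations -/

/-- `W` is a face of `V`: the set of points of `V` at which some linear (i.e. affine) function
`ℓ(x) = δ - ⟨c, x⟩`, non-negative on `V`, vanishes. (The empty set and `V` are allowed.) -/
def IsFace {X : Type*} [AddCommGroup X] [Module ℝ X] (V W : Set X) : Prop :=
  ∃ ℓ : X →ᵃ[ℝ] ℝ, (∀ v ∈ V, 0 ≤ ℓ v) ∧ W = {v ∈ V | ℓ v = 0}

/-- A facet of `V` is an inclusion-maximal face among the faces different from `V`. -/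
def IsFacet {X : Type*} [AddCommGroup X] [Module ℝ X] (V W : Set X) : Prop :=
  Maximal (fun U => IsFace V U ∧ U ≠ V) W

/-- A linear (i.e. affine) function, non-negative on `V`, whose zeros in `V` form a facet. -/
def IsFacetDefining {X : Type*} [AddCommGroup X] [Module ℝ X] (V : Set X)
    (ℓ : X →ᵃ[ℝ] ℝ) : Prop :=
  (∀ v ∈ V, 0 ≤ ℓ v) ∧ IsFacet V {v ∈ V | ℓ v = 0}

/-- `V` is `k`-level: every facet-defining function takes at most `k` distinct values on `V`. -/
def IsKLevel {X : Type*} [AddCommGroup X] [Module ℝ X] (V : Set X) (k : ℕ) : Prop :=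
  ∀ ℓ : X →ᵃ[ℝ] ℝ, IsFacetDefining V ℓ → (ℓ '' V).encard ≤ k

/-- The levelness of `V`: the smallest `k` such that `V` is `k`-level. -/
noncomputable def levelness {X : Type*} [AddCommGroup X] [Module ℝ X] (V : Set X) : ℕ :=
  sInf {k : ℕ | IsKLevel V k}

/-! ### Matroids -/

/-- The base configuration of `M` in `ℝ^E`, with `E` the ground set: the characteristic vectors
of the bases. -/
def baseConfiguration {α : Type*} (M : Matroid α) : Set (M.E → ℝ) :=
  {x | ∃ B : Set α, M.IsBase B ∧ ∀ e : M.E, x e = B.indicator (fun _ => (1 : ℝ)) (e : α)}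

/-- The levelness of a matroid is the levelness of its base configuration. -/
noncomputable def level {α : Type*} (M : Matroid α) : ℕ :=
  levelness (baseConfiguration M)

/-- The class of `k`-level matroids, i.e. the (finite) matroids of levelness at most `k`
(here: those with ground set in a given type). -/
def levelClass (α : Type*) (k : ℕ) : Set (Matroid α) :=
  {M | M.Finite ∧ level M ≤ k}

/-- An excluded minor for a class of matroids: a finite matroid outside the class, all of whose
proper minors are in the class. -/
def IsExcludedMinor {α : Type*} (𝓒 : Set (Matroid α)) (M : Matroid α) : Prop :=
  M.Finite ∧ M ∉ 𝓒 ∧ ∀ N : Matroid α, N <m M → N ∈ 𝓒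

/-- A finite matroid of levelness `k`, all of whose proper minors have smaller levelness. -/
def IsMinimallyLevel {α : Type*} (k : ℕ) (M : Matroid α) : Prop :=
  M.Finite ∧ level M = k ∧ ∀ N : Matroid α, N <m M → level N < level M

/-- Isomorphism of matroids: a bijection of the ground sets that identifies the bases. -/
def Isomorphic {α : Type*} {β : Type*} (M : Matroid α) (N : Matroid β) : Prop :=
  ∃ f : M.E ≃ N.E, ∀ B : Set M.E,
    M.IsBase (Subtype.val '' B) ↔ N.IsBase (Subtype.val '' (f '' B))

end MatroidLevel

/-! Everything is reduced to pairs of disjoint sets `F`, `G` in a minor `N` such that `N|F` and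
`(N/F)|G` are connected and the connectivity `r F + r G - r (F ∪ G)` is at least `j`: such a pair is
`Linked` with parameter `j`. For `j ≥ 1` the key equivalence, `MatroidLevel.lt_level_iff`, is that
the levelness exceeds `j` exactly when some minor has such a pair.

A facet with at least two function values consists of the bases that span some connected `F`, where
`F ∪ G` is a component of the matroid and `G` is connected after contraction of `F`. Up to scaling
and a function constant on bases, the facet is cut out by `r F - #(B ∩ F)`. On bases this takes
exactly the integer values from `0` to the connectivity of the pair. Conversely, a linked pair of a
minor grows to one that covers a component of the whole matroid: contracted elements are absorbed in
the dual, deleted ones in the matroid itself (`Linked.exists_component`). Hence levelness is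
minor-monotone.

In an excluded minor for levelness at most `j`, every linked pair covers the ground set, and each
element that could be deleted or contracted without losing the pair gives a contradiction. This
forces `G` to be a base, `r F = j`, `F` to be minimally connected, and the dual of `(M/F)|G` to be
minimally connected, also of rank `j`. The connectivity is then exactly `j`, so the levelness is
exactly `j + 1`, which is (1). A minimally connected matroid of rank `j ≥ 3` has at most `2 * j - 2`
elements (`Conn.card_le_of_forall_not_conn_erase`). Applied to `F` and to the dual of `(M/F)|G`,
this bounds `#F` and `#G`; with `j = k - 1` it gives (3). Bounded size gives the finiteness in (2).
-/

open Classical in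
/-- An integer-valued matroid rank function on the finite subsets of a type. -/
@[ext]
structure RankFunction (α : Type*) where
  toFun : Finset α → ℤ
  map_empty : toFun ∅ = 0
  le_insert : ∀ e A, toFun A ≤ toFun (insert e A)
  insert_le : ∀ e A, toFun (insert e A) ≤ toFun A + 1
  submod : ∀ A B, toFun (A ∪ B) + toFun (A ∩ B) ≤ toFun A + toFun B

/-! ### Rank functions and connected sets -/

namespace RankFunction

open Finset
open scoped Classical

variable {α : Type*}

instance : CoeFun (RankFunction α) (fun _ => Finset α → ℤ) := ⟨toFun⟩

variable (r : RankFunction α) {A B C D S T X F G K U I : Finset α} {e : α}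

theorem mono (h : A ⊆ B) : r A ≤ r B := by
  have key : ∀ C : Finset α, r A ≤ r (C ∪ A) := by
    intro C
    induction C using Finset.induction_on with
    | empty => simp
    | insert e C _ ih =>
      rw [insert_union]
      exact ih.trans (r.le_insert _ _)
  simpa [union_eq_left.mpr h] using key B

theorem union_le_add_card (A B : Finset α) : r (A ∪ B) ≤ r A + #B := by
  induction B using Finset.induction_on with
  | empty => simp
  | insert e B he ih =>
    rw [union_insert, card_insert_of_notMem he]
    have := r.insert_le e (A ∪ B)
    push_cast
    linarith

theorem le_card (A : Finset α) : r A ≤ #A := by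
  simpa [r.map_empty] using r.union_le_add_card ∅ A

theorem singleton_le (e : α) : r {e} ≤ 1 := by simpa using r.le_card {e}

/-- Submodularity in a form that is convenient for rewriting the sets involved. -/
theorem submod_of_subset (A B : Finset α) (hU : U ⊆ A ∪ B) (hI : I ⊆ A ∩ B) :
    r U + r I ≤ r A + r B := by
  have := r.submod A B
  have := r.mono hU
  have := r.mono hI
  linarith

theorem union_le (h : C ⊆ A ∪ B) : r C ≤ r A + r B := by
  have := r.submod_of_subset A B h (empty_subset _)
  rw [r.map_empty] at this
  linarith

theorem le_erase_add_one (A : Finset α) (e : α) : r A ≤ r (A.erase e) + 1 :=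
  (r.mono (by grind)).trans (r.insert_le e (A.erase e))

/-- The rank function of the contraction of `X`. -/
noncomputable def contract (X : Finset α) : RankFunction α where
  toFun A := r (A ∪ X) - r X
  map_empty := by simp
  le_insert e A := by
    have := r.mono (show A ∪ X ⊆ insert e A ∪ X by grind)
    linarith
  insert_le e A := by
    have := r.insert_le e (A ∪ X)
    rw [insert_union]
    linarith
  submod A B := by
    have := r.submod_of_subset (A ∪ X) (B ∪ X) (U := A ∪ B ∪ X) (I := A ∩ B ∪ X)
      (by grind) (by grind)
    linarith

theorem contract_apply (X A : Finset α) : r.contract X A = r (A ∪ X) - r X := rfl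

/-- The rank function of the dual with respect to the ground set `S`. -/
noncomputable def dual (S : Finset α) : RankFunction α where
  toFun A := #A + r (S \ A) - r S
  map_empty := by simp
  le_insert e A := by
    by_cases he : e ∈ A
    · simp [he]
    · rw [card_insert_of_notMem he]
      have h1 := r.le_erase_add_one (S \ A) e
      rw [show (S \ A).erase e = S \ insert e A by grind] at h1
      push_cast
      linarith
  insert_le e A := by
    have h1 := r.mono (show S \ insert e A ⊆ S \ A by grind)
    have h2 := card_insert_le e A
    have h3 : (#(insert e A) : ℤ) ≤ #A + 1 := by exact_mod_cast h2
    linarith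
  submod A B := by
    have h1 := r.submod_of_subset (S \ A) (S \ B) (U := S \ (A ∩ B)) (I := S \ (A ∪ B))
      (by grind) (by grind)
    have h2 : (#(A ∪ B) : ℤ) + #(A ∩ B) = #A + #B := by exact_mod_cast card_union_add_card_inter A B
    linarith

theorem dual_apply (S A : Finset α) : r.dual S A = #A + r (S \ A) - r S := rfl

/-- The restriction to `S` is a (nonempty) connected matroid. -/
def Conn (S : Finset α) : Prop :=
  S.Nonempty ∧ ∀ D ⊆ S, D.Nonempty → D ≠ S → r S < r D + r (S \ D)

variable {r}

theorem Conn.lt (h : r.Conn S) (hS : ∀ x, x ∈ S ↔ x ∈ A ∨ x ∈ B) (hd : ∀ x ∈ A, x ∉ B)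
    (hA : A.Nonempty) (hB : B.Nonempty) : r S < r A + r B := by
  have hBA : S \ A = B := by grind
  rw [← hBA]
  refine h.2 A (by grind) hA ?_
  rintro rfl
  simp [← hBA] at hB

theorem conn_of_lt (hS : S.Nonempty)
    (h : ∀ A B, (∀ x, x ∈ S ↔ x ∈ A ∨ x ∈ B) → (∀ x ∈ A, x ∉ B) → A.Nonempty → B.Nonempty →
      r S < r A + r B) : r.Conn S :=
  ⟨hS, fun D hD hD1 hD2 => h D (S \ D) (by grind) (by grind) hD1
    (sdiff_nonempty.mpr fun h' => hD2 (hD.antisymm h'))⟩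

theorem exists_of_not_conn (hS : S.Nonempty) (h : ¬ r.Conn S) :
    ∃ A B, (∀ x, x ∈ S ↔ x ∈ A ∨ x ∈ B) ∧ (∀ x ∈ A, x ∉ B) ∧ A.Nonempty ∧ B.Nonempty ∧
      r A + r B ≤ r S := by
  by_contra! hc
  exact h (conn_of_lt hS fun A B h1 h2 h3 h4 => hc A B h1 h2 h3 h4)

theorem Conn.erase (h : r.Conn S) (he : e ∈ S) (hn : (S.erase e).Nonempty) :
    r (S.erase e) = r S := by
  have h1 := h.lt (A := {e}) (B := S.erase e) (by grind) (by simp) (by simp) hn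
  have h2 := r.singleton_le e
  have h3 := r.mono (erase_subset e S)
  linarith

theorem Conn.singleton (h : r.Conn S) (he : e ∈ S) (hn : (S.erase e).Nonempty) : r {e} = 1 := by
  have h1 := h.lt (A := {e}) (B := S.erase e) (by grind) (by simp) (by simp) hn
  have h2 := r.singleton_le e
  have h3 := r.mono (erase_subset e S)
  linarith

/-- Deleting or contracting an element of a connected matroid leaves a connected matroid. -/
theorem Conn.erase_or_contract (h : r.Conn S) (he : e ∈ S) (hn : (S.erase e).Nonempty) :
    r.Conn (S.erase e) ∨ (r.contract {e}).Conn (S.erase e) := by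
  by_contra! hc
  obtain ⟨A, B, hAB, hd, hA, hB, h1⟩ := exists_of_not_conn hn hc.1
  obtain ⟨C, D, hCD, hd', hC, hD, h2⟩ := exists_of_not_conn hn hc.2
  have he1 := h.singleton he hn
  have he2 := h.erase he hn
  simp only [contract_apply] at h2
  rw [show S.erase e ∪ {e} = S by grind] at h2
  simp only [mem_erase] at hAB hCD
  -- Uncrossing: if `A ∩ C` and `B ∩ D` were both nonempty, two submodular inequalities would
  -- contradict the connectedness of `S`; the two strict inequalities gain 2 in integers, against an
  -- excess of 1 from contracting `e`. Used also with `C`, `D` swapped, this makes one of `A`, `B`,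
  -- `C`, `D` empty.
  have key : ∀ C D, (∀ x, x ≠ e ∧ x ∈ S ↔ x ∈ C ∨ x ∈ D) → (∀ x ∈ C, x ∉ D) →
      r (C ∪ {e}) + r (D ∪ {e}) ≤ r S + 1 → ¬ (A ∩ C).Nonempty ∨ ¬ (B ∩ D).Nonempty := by
    intro C D hCD hd' h2
    by_contra! hc
    have k1 := r.submod_of_subset A (C ∪ {e}) (U := A ∪ C ∪ {e}) (I := A ∩ C) (by grind) (by grind)
    have k2 := r.submod_of_subset B (D ∪ {e}) (U := B ∪ D ∪ {e}) (I := B ∩ D) (by grind) (by grind)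
    have k3 := h.lt (A := A ∪ C ∪ {e}) (B := B ∩ D) (by grind) (by grind) (by simp) hc.2
    have k4 := h.lt (A := B ∪ D ∪ {e}) (B := A ∩ C) (by grind) (by grind) (by simp) hc.1
    linarith
  have k1 := key C D hCD hd' (by linarith)
  have k2 := key D C (by grind) (by grind) (by linarith)
  obtain ⟨a, ha⟩ := hA
  obtain ⟨b, hb⟩ := hB
  obtain ⟨c, hc⟩ := hC
  obtain ⟨d, hd1⟩ := hD
  simp only [not_nonempty_iff_eq_empty, eq_empty_iff_forall_notMem, mem_inter] at k1 k2
  grind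

/-- Submodularity for `T`, `A` and then for `T ∪ A`, `B`. A separation thus induces one on every
subset, so a connected set lies on one side. -/
theorem modular_inter (hAB : r A + r B ≤ r (A ∪ B)) (T : Finset α) :
    r (T ∩ A) + r (T ∩ B) ≤ r T := by
  have h1 := r.submod_of_subset T A (U := T ∪ A) (I := T ∩ A) (by grind) (by grind)
  have h2 := r.submod_of_subset (T ∪ A) B (U := A ∪ B) (I := T ∩ B) (by grind) (by grind)
  linarith

theorem Conn.subset_or_subset (h : r.Conn T) (hT : ∀ x ∈ T, x ∈ A ∨ x ∈ B)
    (hd : ∀ x ∈ A, x ∉ B) (hAB : r A + r B ≤ r (A ∪ B)) :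
    (∀ x ∈ T, x ∈ A) ∨ (∀ x ∈ T, x ∈ B) := by
  have h1 := modular_inter hAB T
  by_contra! hc
  obtain ⟨⟨x, hx, hx'⟩, y, hy, hy'⟩ := hc
  have h2 := h.lt (A := T ∩ A) (B := T ∩ B) (by grind) (by grind) ⟨y, by grind⟩ ⟨x, by grind⟩
  linarith

end RankFunction

/-! ### Linked pairs: extension, duality, passage from minors to components -/

namespace RankFunction

open Finset
open scoped Classical

variable {α : Type*} {r r' : RankFunction α} {A B C D S T X F G K U I : Finset α} {e : α} {j : ℤ}

theorem contract_contract (r : RankFunction α) (X Y : Finset α) :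
    (r.contract X).contract Y = r.contract (X ∪ Y) := by
  ext A
  simp only [contract_apply]
  rw [show A ∪ Y ∪ X = A ∪ (X ∪ Y) by grind, union_comm Y X]
  ring

@[simp] theorem contract_empty (r : RankFunction α) : r.contract ∅ = r := by
  ext A
  simp [contract_apply, r.map_empty]

theorem Conn.congr (h : r.Conn S) (hr : ∀ A ⊆ S, r A = r' A) : r'.Conn S := by
  refine conn_of_lt h.1 fun A B h1 h2 h3 h4 => ?_
  rw [← hr S subset_rfl, ← hr A (by grind), ← hr B (by grind)]
  exact h.lt h1 h2 h3 h4

/-- `F` and `G` are disjoint, the restriction to `F` and the contraction of `F` restricted to `G`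
are connected, and the connectivity of the pair is at least `j`. -/
structure Linked (r : RankFunction α) (F G : Finset α) (j : ℤ) : Prop where
  left : r.Conn F
  right : (r.contract F).Conn G
  disj : ∀ x ∈ F, x ∉ G
  le : r (F ∪ G) + j ≤ r F + r G

theorem Linked.congr (h : r.Linked F G j) (hr : ∀ A ⊆ F ∪ G, r A = r' A) : r'.Linked F G j where
  left := h.left.congr fun A hA => hr A (by grind)
  right := h.right.congr fun A hA => by
    rw [contract_apply, contract_apply, hr _ (by grind), hr F (by grind)]
  disj := h.disj
  le := by
    rw [← hr _ subset_rfl, ← hr F (by grind), ← hr G (by grind)]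
    exact h.le

/-- In a separation of `F ∪ G` one side contains `F`. If it is larger than `F`, it separates `G` in
the contraction of `F`; if it equals `F`, the connectivity would be 0. -/
theorem Linked.conn_union (h : r.Linked F G j) (hj : 1 ≤ j) : r.Conn (F ∪ G) := by
  obtain ⟨f, hf⟩ := h.left.1
  have key : ∀ A B : Finset α, (∀ x, x ∈ F ∪ G ↔ x ∈ A ∨ x ∈ B) → (∀ x ∈ A, x ∉ B) →
      B.Nonempty → (∀ x ∈ F, x ∈ A) → r (F ∪ G) < r A + r B := by
    intro A B h1 h2 hB hFA
    have hd := h.disj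
    by_cases hA : (A \ F).Nonempty
    · have k := h.right.lt (A := A \ F) (B := B) (by grind) (by grind) hA hB
      simp only [contract_apply] at k
      rw [show A \ F ∪ F = A by grind, union_comm G F] at k
      have k2 := r.union_le (C := B ∪ F) (A := B) (B := F) subset_rfl
      linarith
    · rw [not_nonempty_iff_eq_empty, sdiff_eq_empty_iff_subset] at hA
      have k := h.le
      rw [show A = F by grind, show B = G by grind]
      linarith
  refine conn_of_lt ⟨f, by grind⟩ fun A B h1 h2 hA hB => ?_
  by_contra! hc
  have hU : A ∪ B = F ∪ G := by grind
  rcases h.left.subset_or_subset (A := A) (B := B) (by grind) h2 (by rw [hU]; exact hc) with hF | hF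
  · exact absurd (key A B h1 h2 hB hF) (by linarith)
  · exact absurd (key B A (by clear key; grind) (by clear key; grind) hA hF) (by linarith)

/-- `K` is a minimal separator of `S` that contains `A`. If `K` split, the connected set `A` of the
contraction would lie on one side, which would be a smaller separator. -/
theorem exists_component (h : (r.contract X).Conn A) (hA : A ⊆ S) (hX : X ⊆ S) :
    ∃ K, A ⊆ K ∧ K ⊆ S ∧ r.Conn K ∧ r K + r (S \ K) ≤ r S := by
  obtain ⟨K, hKS, ⟨hAK, hsep⟩, hmin⟩ := exists_minimal_le_of_wellFoundedLT
    (fun K : Finset α => A ⊆ K ∧ r K + r (S \ K) ≤ r S) S (by simp [hA, r.map_empty])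
  replace hKS : K ⊆ S := hKS
  replace hmin : ∀ C, A ⊆ C → r C + r (S \ C) ≤ r S → C ⊆ K → K ⊆ C := fun C h1 h2 => hmin ⟨h1, h2⟩
  refine ⟨K, hAK, hKS, ?_, hsep⟩
  by_contra hc
  obtain ⟨C, D, h1, h2, hC, hD, h3⟩ := exists_of_not_conn (h.1.mono hAK) hc
  have key : ∀ C D : Finset α, (∀ x, x ∈ K ↔ x ∈ C ∨ x ∈ D) → (∀ x ∈ C, x ∉ D) → D.Nonempty →
      r C + r D ≤ r K → ¬ ∀ x ∈ A, x ∈ C := by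
    intro C D h1 h2 hD h3 hAC
    have k1 := r.union_le (C := S \ C) (A := D) (B := S \ K) (by grind)
    have k2 := hmin C hAC (by linarith) (by grind)
    obtain ⟨d, hd⟩ := hD
    grind
  clear hmin
  have m1 : r K + r (S \ K) ≤ r (K ∪ S \ K) := by rwa [union_sdiff_of_subset hKS]
  have m2 : r C + r D ≤ r (C ∪ D) := by rwa [show C ∪ D = K by clear key; grind]
  by_cases hn : (A ∩ C).Nonempty ∧ (A ∩ D).Nonempty
  · clear key
    have k := h.lt (A := A ∩ C) (B := A ∩ D) (by grind) (by grind) hn.1 hn.2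
    simp only [contract_apply] at k
    have k1 := modular_inter m1 (A ∪ X)
    have k2 := modular_inter m2 ((A ∪ X) ∩ K)
    have k3 := r.union_le (C := X) (A := X ∩ C) (B := (X ∩ D) ∪ (X ∩ (S \ K))) (by grind)
    have k4 := r.union_le (C := (X ∩ D) ∪ (X ∩ (S \ K))) subset_rfl
    have k5 := r.submod_of_subset ((A ∪ X) ∩ K ∩ C) X (U := A ∩ C ∪ X) (I := X ∩ C)
      (by grind) (by grind)
    have k6 := r.submod_of_subset ((A ∪ X) ∩ K ∩ D) X (U := A ∩ D ∪ X) (I := X ∩ D)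
      (by grind) (by grind)
    have k7 := r.mono (show X ∩ (S \ K) ⊆ (A ∪ X) ∩ (S \ K) by grind)
    linarith
  · simp only [not_and_or, not_nonempty_iff_eq_empty, eq_empty_iff_forall_notMem, mem_inter] at hn
    rcases hn with hn | hn
    · exact key D C (by clear key; grind) (by clear key; grind) hC (by linarith)
        (by clear key; grind)
    · exact key C D h1 h2 hD h3 (by clear key; grind)

/-- A side of a separation of `F ∪ B` that avoids `F` is also a side of a separation of `S`, because
`A` and `B` are skew after contracting `F`. -/
theorem Conn.union_of_contract_split (hS : r.Conn S) (hF : r.Conn F)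
    (hSU : ∀ x, x ∈ S ↔ x ∈ F ∨ x ∈ A ∨ x ∈ B)
    (h : r (F ∪ A) + r (F ∪ B) ≤ r S + r F) : r.Conn (F ∪ B) := by
  obtain ⟨f, hf⟩ := hF.1
  have key : ∀ D D' : Finset α, (∀ x, x ∈ F ∪ B ↔ x ∈ D ∨ x ∈ D') → (∀ x ∈ D, x ∉ D') →
      D.Nonempty → r D + r D' ≤ r (F ∪ B) → ¬ ∀ x ∈ F, x ∈ D' := by
    intro D D' h1 h2 hD h3 hFD
    have k1 := hS.lt (A := D) (B := S \ D) (by grind) (by grind) hD ⟨f, by grind⟩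
    have k2 := r.submod_of_subset D' (F ∪ A) (U := S \ D) (I := F) (by grind) (by grind)
    linarith
  refine conn_of_lt ⟨f, by grind⟩ fun D D' h1 h2 hD hD' => ?_
  by_contra! hc
  rcases hF.subset_or_subset (A := D) (B := D') (by grind) h2
    (by rw [show D ∪ D' = F ∪ B by grind]; exact hc) with hF | hF
  · exact key D' D (by grind) (by grind) hD' (by linarith) hF
  · exact key D D' h1 h2 hD hc hF

/-- A linked pair inside a connected set extends to a linked pair that covers the set. -/
theorem Linked.exists_extend (h : r.Linked F G j) (hS : r.Conn S) (hFG : F ∪ G ⊆ S) :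
    ∃ F' G', (∀ x, x ∈ S ↔ x ∈ F' ∨ x ∈ G') ∧ r.Linked F' G' j := by
  -- The rank condition makes the contractions of `F` and of `F'` agree on subsets of `G`, so `G`
  -- stays connected while `F` grows.
  obtain ⟨F', hFF', hF', hmax⟩ := exists_le_maximal (a := F)
    (S.powerset.filter fun F' => (∀ x ∈ F', x ∉ G) ∧ r.Conn F' ∧
      r (F' ∪ G) - r F' = r (F ∪ G) - r F) (by
        simpa [h.left] using ⟨by grind, h.disj⟩)
  replace hFF' : F ⊆ F' := hFF'
  simp only [mem_filter, mem_powerset] at hF' hmax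
  obtain ⟨hFS, hdG, hcF', hskew⟩ := hF'
  replace hmax : ∀ T, T ⊆ S → (∀ x ∈ T, x ∉ G) → r.Conn T →
      r (T ∪ G) - r T = r (F ∪ G) - r F → F' ⊆ T → T ⊆ F' :=
    fun T h1 h2 h3 h4 => hmax ⟨h1, h2, h3, h4⟩
  have hGne := h.right.1
  refine ⟨F', S \ F', by grind, hcF', ?_, by grind, ?_⟩
  · by_contra hc
    have hne : (S \ F').Nonempty := by
      obtain ⟨g, hg⟩ := hGne
      exact ⟨g, by grind⟩
    obtain ⟨A, B, h1, h2, hA, hB, h3⟩ := exists_of_not_conn hne hc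
    simp only [contract_apply] at h3
    rw [show S \ F' ∪ F' = S by grind] at h3
    -- A side of the split that misses `G` could be absorbed into `F'`, against maximality.
    have key : ∀ A B : Finset α, (∀ x, x ∈ S \ F' ↔ x ∈ A ∨ x ∈ B) → (∀ x ∈ A, x ∉ B) →
        B.Nonempty → r (A ∪ F') + r (B ∪ F') ≤ r S + r F' → ¬ ∀ x ∈ G, x ∈ A := by
      intro A B h1 h2 hB h3 hGA
      have k1 : r.Conn (F' ∪ B) := hS.union_of_contract_split hcF' (A := A) (by grind)
        (by rw [union_comm F' A, union_comm F' B]; linarith)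
      have k2 : r (F' ∪ B ∪ G) - r (F' ∪ B) = r (F ∪ G) - r F := by
        have q1 := r.submod_of_subset (F' ∪ B) (F' ∪ G) (U := F' ∪ B ∪ G) (I := F')
          (by grind) (by grind)
        have q2 := r.submod_of_subset (F' ∪ B ∪ G) (A ∪ F') (U := S) (I := F' ∪ G)
          (by grind) (by grind)
        rw [union_comm B F'] at h3
        linarith
      have k3 := hmax (F' ∪ B) (by grind) (by grind) k1 k2 (by grind)
      obtain ⟨b, hb⟩ := hB
      grind
    by_cases hn : (G ∩ A).Nonempty ∧ (G ∩ B).Nonempty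
    · clear hmax key
      have k := h.right.lt (A := G ∩ A) (B := G ∩ B) (by grind) (by grind) hn.1 hn.2
      simp only [contract_apply] at k
      have q : ∀ A ⊆ G, r (A ∪ F') - r F' = r (A ∪ F) - r F := by
        intro A hA
        have q1 := r.submod_of_subset F' (A ∪ F) (U := A ∪ F') (I := F) (by grind) (by grind)
        have q2 := r.submod_of_subset (A ∪ F') (F ∪ G) (U := F' ∪ G) (I := A ∪ F)
          (by grind) (by grind)
        linarith
      have k2 := q (G ∩ A) (by grind)
      have k3 := q (G ∩ B) (by grind)
      have k4 := q G subset_rfl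
      clear q
      have k5 := r.submod_of_subset (A ∪ F') (G ∪ F') (U := A ∪ G ∪ F') (I := G ∩ A ∪ F')
        (by grind) (by grind)
      have k6 := r.submod_of_subset (A ∪ G ∪ F') (B ∪ F') (U := S) (I := G ∩ B ∪ F')
        (by grind) (by grind)
      linarith
    · simp only [not_and_or, not_nonempty_iff_eq_empty, eq_empty_iff_forall_notMem,
        mem_inter] at hn
      rcases hn with hn | hn
      · exact key B A (by clear key hmax; grind) (by clear key hmax; grind) hA (by linarith)
          (by clear key hmax; grind)
      · exact key A B h1 h2 hB (by linarith) (by clear key hmax; grind)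
  · clear hmax
    have k := h.le
    have q1 := r.submod_of_subset F' (F ∪ (S \ F')) (U := S) (I := F) (by grind) (by grind)
    have q2 := r.submod_of_subset (S \ F') (F ∪ G) (U := F ∪ (S \ F')) (I := G)
      (by grind) (by grind)
    rw [show F' ∪ S \ F' = S by grind]
    linarith

theorem card_of_split (h1 : ∀ x, x ∈ U ↔ x ∈ A ∨ x ∈ B) (h2 : ∀ x ∈ A, x ∉ B) :
    (#U : ℤ) = #A + #B := by
  rw [show U = A ∪ B by grind, card_union_of_disjoint (disjoint_left.mpr h2)]
  push_cast; rfl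

theorem Conn.dual (h : r.Conn S) : (r.dual S).Conn S := by
  refine conn_of_lt h.1 fun A B h1 h2 hA hB => ?_
  have k := h.lt h1 h2 hA hB
  have hc := card_of_split h1 h2
  simp only [dual_apply, Finset.sdiff_self, r.map_empty]
  rw [show S \ A = B by grind, show S \ B = A by grind]
  linarith

theorem dual_dual_apply (r : RankFunction α) (h : A ⊆ S) : (r.dual S).dual S A = r A := by
  have hc : (#S : ℤ) = #A + #(S \ A) := by
    rw [card_sdiff_of_subset h, Nat.cast_sub (card_le_card h)]
    ring
  simp only [dual_apply, Finset.sdiff_self, r.map_empty, Finset.sdiff_sdiff_eq_self h]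
  linarith

/-- Duality exchanges restriction and contraction and preserves the connectivity of a pair. The pair
is reversed, and the contracted set `X` becomes a deleted one. -/
theorem Linked.dual (h : (r.contract X).Linked F G j)
    (hS : ∀ x, x ∈ S ↔ x ∈ X ∨ x ∈ F ∨ x ∈ G) (hF : ∀ x ∈ X, x ∉ F) (hG : ∀ x ∈ X, x ∉ G) :
    (r.dual S).Linked G F j := by
  have hd := h.disj
  have hr := h.right
  rw [contract_contract] at hr
  refine ⟨conn_of_lt hr.1 fun A B h1 h2 hA hB => ?_,
    conn_of_lt h.left.1 fun A B h1 h2 hA hB => ?_, by grind, ?_⟩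
  · have k := hr.lt h1 h2 hA hB
    have hc := card_of_split h1 h2
    simp only [dual_apply, contract_apply] at k ⊢
    rw [show S \ G = X ∪ F by grind, show S \ A = B ∪ (X ∪ F) by grind,
      show S \ B = A ∪ (X ∪ F) by grind]
    rw [show G ∪ (X ∪ F) = S by grind] at k
    linarith
  · have k := h.left.lt h1 h2 hA hB
    have hc1 := card_of_split (U := F ∪ G) (A := A ∪ G) (B := B) (by grind) (by grind)
    have hc2 := card_of_split (U := A ∪ G) (A := A) (B := G) (by grind) (by grind)
    have hc3 := card_of_split (U := B ∪ G) (A := B) (B := G) (by grind) (by grind)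
    simp only [dual_apply, contract_apply] at k ⊢
    rw [show S \ (F ∪ G) = X by grind, show S \ (A ∪ G) = B ∪ X by grind,
      show S \ (B ∪ G) = A ∪ X by grind, show S \ G = F ∪ X by grind]
    linarith
  · have k := h.le
    have hc1 := card_of_split (U := G ∪ F) (A := G) (B := F) (by grind) (by grind)
    simp only [dual_apply, contract_apply] at k ⊢
    rw [show S \ (G ∪ F) = X by grind, show S \ G = F ∪ X by grind, show S \ F = G ∪ X by grind]
    rw [show F ∪ G ∪ X = S by grind] at k
    linarith

theorem eq_inter_add_sdiff (hK : K ⊆ S) (hsep : r K + r (S \ K) ≤ r S) (hT : T ⊆ S) :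
    r T = r (T ∩ K) + r (T \ K) := by
  have m1 := modular_inter (r := r) (A := K) (B := S \ K)
    (by rwa [union_sdiff_of_subset hK]) T
  have m2 := r.union_le (C := T) (A := T ∩ K) (B := T \ K) (by grind)
  rw [show T ∩ (S \ K) = T \ K by grind] at m1
  linarith

/-- A linked pair of a minor yields a linked pair of the whole matroid that covers a component. -/
theorem Linked.exists_component (h : (r.contract X).Linked F G j) (hj : 1 ≤ j)
    (hXS : X ⊆ S) (hFS : F ⊆ S) (hGS : G ⊆ S) (hF : ∀ x ∈ X, x ∉ F) (hG : ∀ x ∈ X, x ∉ G) :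
    ∃ F' G', F' ∪ G' ⊆ S ∧ r.Conn (F' ∪ G') ∧ r (F' ∪ G') + r (S \ (F' ∪ G')) ≤ r S ∧
      r.Linked F' G' j := by
  have hd := h.disj
  obtain ⟨K, hK1, hK2, hK, hsep⟩ := RankFunction.exists_component (S := X ∪ F ∪ G) (h.conn_union hj)
    (by grind) (by grind)
  -- The part of `X` outside the separator `K` does not affect ranks inside `K`.
  have h' : (r.contract (K \ (F ∪ G))).Linked F G j := by
    refine h.congr fun A hA => ?_
    simp only [contract_apply]
    have k1 := eq_inter_add_sdiff hK2 hsep (T := A ∪ X) (by grind)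
    have k2 := eq_inter_add_sdiff hK2 hsep (T := X) (by grind)
    have e1 : (A ∪ X) \ K = X \ K := by grind
    have e2 : (A ∪ X) ∩ K = A ∪ K \ (F ∪ G) := by grind
    have e3 : X ∩ K = K \ (F ∪ G) := by grind
    rw [k1, k2, e1, e2, e3]
    ring
  -- In the dual the contracted elements are merely deleted, so the extension absorbs them.
  obtain ⟨G1, F1, hU1, h1⟩ := (h'.dual (S := K) (by grind) (by grind) (by grind)).exists_extend
    hK.dual (by grind)
  have h2 : r.Linked F1 G1 j := by
    have q : (((r.dual K).contract ∅).Linked G1 F1 j) := by rwa [contract_empty]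
    refine (q.dual (S := K) (by grind) (by simp) (by simp)).congr fun A hA => ?_
    exact r.dual_dual_apply (by grind)
  -- `K` is a component of `X ∪ F ∪ G` only; a second extension, in the matroid itself, reaches the
  -- component of `S`.
  have h3 : r.Conn K := hK
  rw [← contract_empty r] at h3
  obtain ⟨K', hK1', hK2', hK', hsep'⟩ := RankFunction.exists_component (S := S) h3
    (by grind) (empty_subset _)
  obtain ⟨F', G', hU, h4⟩ := h2.exists_extend hK' (by grind)
  have hU' : F' ∪ G' = K' := by grind
  exact ⟨F', G', by grind, by rwa [hU'], by rwa [hU'], h4⟩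

end RankFunction

/-! ### Size of minimally connected matroids -/

namespace RankFunction

open Finset
open scoped Classical

variable {α : Type*} {r r' : RankFunction α} {A B C D S T X F G K U I : Finset α} {e : α} {j : ℤ}

theorem conn_of_card_three (hT : #T = 3) (hr : r T ≤ 2) (h1 : ∀ x ∈ T, 1 ≤ r {x})
    (h2 : ∀ x ∈ T, ∀ y ∈ T, x ≠ y → 2 ≤ r {x, y}) : r.Conn T := by
  refine conn_of_lt (card_pos.mp (by omega)) fun A B hS hd hA hB => ?_
  have hc := card_of_split hS hd
  have one : ∀ A ⊆ T, A.Nonempty → 1 ≤ r A := by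
    rintro A hAT ⟨x, hx⟩
    exact (h1 x (hAT hx)).trans (r.mono (by simpa using hx))
  have two : ∀ A ⊆ T, 1 < #A → 2 ≤ r A := by
    intro A hAT hc
    obtain ⟨x, hx, y, hy, hxy⟩ := one_lt_card.mp hc
    exact (h2 x (hAT hx) y (hAT hy) hxy).trans (r.mono (by grind))
  have hAT : A ⊆ T := by intro x; grind
  have hBT : B ⊆ T := by intro x; grind
  have k1 := one A hAT hA
  have k2 := one B hBT hB
  by_cases h : 1 < #A
  · have := two A hAT h
    linarith
  · have := two B hBT (by omega)
    linarith

/-- `e` is an element of the connected set `S`, and `A`, `B` is a separation of `S \ e`. -/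
structure Splits (r : RankFunction α) (S : Finset α) (e : α) (A B : Finset α) : Prop where
  conn : r.Conn S
  mem_iff : ∀ x, x ∈ S ↔ x = e ∨ x ∈ A ∨ x ∈ B
  notMem_left : e ∉ A
  notMem_right : e ∉ B
  disj : ∀ x ∈ A, x ∉ B
  left : A.Nonempty
  right : B.Nonempty
  le : r A + r B ≤ r S

namespace Splits

variable (h : r.Splits S e A B)
include h

theorem symm : r.Splits S e B A where
  conn := h.conn
  mem_iff := by have := h.mem_iff; grind
  notMem_left := h.notMem_right
  notMem_right := h.notMem_left
  disj := by have := h.disj; grind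
  left := h.right
  right := h.left
  le := by linarith [h.le]

theorem rank_erase : r (A ∪ B) = r S := by
  have h1 := h.mem_iff
  have h2 := h.notMem_left
  have h3 := h.notMem_right
  have h4 : S.erase e = A ∪ B := by grind
  rw [← h4]
  refine h.conn.erase (by grind) ?_
  rw [h4]
  exact h.left.mono subset_union_left

theorem rank_eq : r A + r B = r S := by
  have h1 := h.rank_erase
  have h2 := r.union_le (C := A ∪ B) subset_rfl
  linarith [h.le]

theorem modular (T : Finset α) : r (T ∩ A) + r (T ∩ B) ≤ r T :=
  modular_inter (by rw [h.rank_erase]; exact h.le) T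

theorem contract_of_subset (hC : C ⊆ A) : r.contract B C = r C := by
  have hd := h.disj
  rw [contract_apply]
  have h1 := h.modular (C ∪ B)
  have h2 := r.union_le (C := C ∪ B) subset_rfl
  rw [show (C ∪ B) ∩ A = C by grind, show (C ∪ B) ∩ B = B by grind] at h1
  linarith

theorem contract_insert : r.contract B (insert e A) = r A := by
  have h1 := h.mem_iff
  rw [contract_apply, show insert e A ∪ B = S by grind]
  linarith [h.rank_eq]

/-- This is one summand of the series decomposition of `S` at `e`: a separation `C`, `D` of it with
`e ∈ D` lifts to the separation `C`, `D ∪ B` of `S`. -/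
theorem conn_contract : (r.contract B).Conn (insert e A) := by
  have h1 := h.mem_iff
  have h2 := h.notMem_left
  have h3 := h.notMem_right
  have hd := h.disj
  have key : ∀ C D : Finset α, (∀ x, x ∈ insert e A ↔ x ∈ C ∨ x ∈ D) → (∀ x ∈ C, x ∉ D) →
      C.Nonempty → D.Nonempty → e ∈ D →
      r.contract B (insert e A) < r.contract B C + r.contract B D := by
    intro C D k1 k2 hC hD he
    rw [h.contract_insert, h.contract_of_subset (C := C) (by grind), contract_apply]
    have k := h.conn.lt (A := C) (B := D ∪ B) (by grind) (by grind) hC ⟨e, by simp [he]⟩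
    linarith [h.rank_eq]
  refine conn_of_lt ⟨e, by simp⟩ fun C D k1 k2 hC hD => ?_
  by_cases he : e ∈ D
  · exact key C D k1 k2 hC hD he
  · rw [add_comm]
    exact key D C (by clear key; grind) (by clear key; grind) hD hC (by clear key; grind)

/-- Makes the summand inherit minimality. A side of a separation of `S.erase f` that avoids `e` but
meets `A` separates the summand without `f`; if it misses `A`, then `f` is spanned by the other side
and can be put back. -/
theorem conn_erase_of_conn_contract {f : α} (hf : f ∈ A) (hn : (A.erase f).Nonempty)
    (hc : (r.contract B).Conn ((insert e A).erase f)) : r.Conn (S.erase f) := by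
  have h1 := h.mem_iff
  have h2 := h.notMem_left
  have h3 := h.notMem_right
  have hd := h.disj
  obtain ⟨g, hg⟩ := hn
  have q1 : r.contract B ((insert e A).erase f) = r A := by
    rw [h.conn_contract.erase (by grind) ⟨g, by grind⟩, h.contract_insert]
  have q2 : r (A.erase f) = r A := by
    have q3 := hc.erase (e := e) (by grind) ⟨g, by grind⟩
    have q4 : ((insert e A).erase f).erase e = A.erase f := by grind
    rw [q1, q4, h.contract_of_subset (by grind)] at q3
    exact q3
  have key : ∀ C D : Finset α, (∀ x, x ∈ S.erase f ↔ x ∈ C ∨ x ∈ D) → (∀ x ∈ C, x ∉ D) →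
      C.Nonempty → e ∈ D → r (S.erase f) < r C + r D := by
    intro C D k1 k2 hC he
    refine (r.mono (erase_subset f S)).trans_lt ?_
    by_cases hCA : (C ∩ A).Nonempty
    · have m1 := h.modular C
      have m2 := h.modular (D ∩ A ∪ D ∩ B)
      have k := hc.lt (A := C ∩ A) (B := insert e (D ∩ A)) (by grind) (by grind) hCA (by simp)
      rw [q1, h.contract_of_subset (C := C ∩ A) (by grind), contract_apply] at k
      have s1 := r.submod_of_subset D (D ∩ A ∪ B) (U := insert e (D ∩ A) ∪ B)
        (I := D ∩ A ∪ D ∩ B) (by grind) (by grind)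
      have s2 := r.union_le (C := D ∩ A ∪ B) subset_rfl
      have s3 := r.union_le (C := B) (A := C ∩ B) (B := D ∩ B) (by grind)
      rw [show (D ∩ A ∪ D ∩ B) ∩ A = D ∩ A by grind,
        show (D ∩ A ∪ D ∩ B) ∩ B = D ∩ B by grind] at m2
      linarith [h.rank_eq]
    · simp only [not_nonempty_iff_eq_empty, eq_empty_iff_forall_notMem, mem_inter] at hCA
      have s1 := r.submod_of_subset D A (U := insert f D) (I := A.erase f) (by grind) (by grind)
      have k := h.conn.lt (A := C) (B := insert f D) (by grind) (by grind) hC (by simp)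
      linarith
  refine conn_of_lt ⟨e, by grind⟩ fun C D k1 k2 hC hD => ?_
  by_cases he : e ∈ D
  · exact key C D k1 k2 hC he
  · rw [add_comm]
    exact key D C (by clear key; grind) (by clear key; grind) hD (by clear key; grind)

/-- The given separation induces one of `A.erase f` unless `{e}` is a side, and it is not, since
`A.erase f` already has the full rank. -/
theorem not_conn_erase {f : α} (hf : f ∈ A) (hn : (A.erase f).Nonempty) (hA : r.Conn A)
    (hc : ¬ (r.contract B).Conn ((insert e A).erase f)) : ¬ r.Conn (A.erase f) := by
  intro hAf
  have h2 := h.notMem_left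
  obtain ⟨C, D, k1, k2, hC, hD, hle⟩ := exists_of_not_conn ⟨e, by grind⟩ hc
  have q1 := hA.erase hf hn
  have q2 : r.contract B {e} = 1 := h.conn_contract.singleton (by simp) (by
    rw [erase_insert h2]; exact h.left)
  have q3 : r.contract B ((insert e A).erase f) ≤ r A := by
    rw [← h.contract_insert]
    exact (r.contract B).mono (erase_subset _ _)
  have key : ∀ C D : Finset α, (∀ x, x ∈ (insert e A).erase f ↔ x ∈ C ∨ x ∈ D) →
      (∀ x ∈ C, x ∉ D) → C.Nonempty → e ∈ D →
      r.contract B C + r.contract B D ≤ r.contract B ((insert e A).erase f) → False := by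
    intro C D k1 k2 hC he hle
    rw [h.contract_of_subset (C := C) (by grind)] at hle
    by_cases hD : (D.erase e).Nonempty
    · have k := hAf.lt (A := C) (B := D.erase e) (by grind) (by grind) hC hD
      have k3 := (r.contract B).mono (erase_subset e D)
      rw [h.contract_of_subset (C := D.erase e) (by grind)] at k3
      linarith
    · rw [not_nonempty_iff_eq_empty] at hD
      have hD' : D = {e} := by
        rw [← insert_erase he, hD, insert_empty_eq]
      subst hD'
      rw [show C = A.erase f by clear hD; grind] at hle
      linarith
  by_cases he : e ∈ D
  · exact key C D k1 k2 hC he hle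
  · exact key D C (by clear key; grind) (by clear key; grind) hD (by clear key; grind)
      (by linarith)

/-- Excludes the triangle `U_{2,3}` as a part: `e` is parallel to at most one of its elements, and
deleting that one leaves another triangle. Minimizing the rank of `{e, f}` selects it. -/
theorem exists_conn_erase (hA : r.Conn A) (h3 : #A = 3) (hr : r A = 2) :
    ∃ f ∈ A, (r.contract B).Conn ((insert e A).erase f) := by
  have h2 := h.notMem_left
  have q2 : r.contract B {e} = 1 := h.conn_contract.singleton (by simp) (by
    rw [erase_insert h2]; exact h.left)
  have q3 : r.contract B (insert e A) = 2 := by rw [h.contract_insert, hr]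
  have pair : ∀ x ∈ A, ∀ y ∈ A, x ≠ y → 2 ≤ r.contract B {x, y} := by
    intro x hx y hy hxy
    rw [h.contract_of_subset (by grind)]
    have hc : #(A \ {x, y}) = 1 := by
      rw [card_sdiff_of_subset (by grind), card_pair hxy, h3]
    have k := hA.lt (A := {x, y}) (B := A \ {x, y}) (by grind) (by grind) (by simp)
      (card_pos.mp (by omega))
    have k2 := r.le_card (A \ {x, y})
    rw [hc] at k2
    push_cast at k2
    linarith
  have epair : ∀ x ∈ A, ∀ y ∈ A, x ≠ y → 3 ≤ r.contract B {e, x} + r.contract B {e, y} := by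
    intro x hx y hy hxy
    have k1 := pair x hx y hy hxy
    have k2 := (r.contract B).submod_of_subset {e, x} {e, y} (U := {x, y}) (I := {e})
      (by grind) (by grind)
    linarith
  have hne : A.Nonempty := h.left
  obtain ⟨f, hf, hmin⟩ := exists_min_image A (fun f => r.contract B {e, f}) hne
  refine ⟨f, hf, conn_of_card_three ?_ ?_ ?_ ?_⟩
  · rw [card_erase_of_mem (by grind), card_insert_of_notMem h2, h3]
  · exact ((r.contract B).mono (erase_subset _ _)).trans q3.le
  · intro x hx
    have hxS : x ∈ insert e A := mem_of_mem_erase hx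
    refine (h.conn_contract.singleton hxS ?_).ge
    refine ⟨if x = e then f else e, ?_⟩
    split_ifs <;> grind
  · have ex : ∀ x ∈ A, x ≠ f → 2 ≤ r.contract B {e, x} := by
      intro x hx hxf
      have k1 := hmin x hx
      have k2 := epair x hx f hf hxf
      linarith
    intro x hx y hy hxy
    simp only [mem_erase, mem_insert] at hx hy
    rcases hx with ⟨hx1, rfl | hx⟩
    · rcases hy with ⟨hy1, rfl | hy⟩
      · exact absurd rfl hxy
      · exact ex y hy hy1
    · rcases hy with ⟨hy1, rfl | hy⟩
      · rw [pair_comm]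
        exact ex x hx hx1
      · exact pair x hx y hy hxy

end Splits

/-- A minimally connected matroid of rank `ρ ≥ 3` has at most `2 * ρ - 2` elements. -/
theorem Conn.card_le_of_forall_not_conn_erase (h : r.Conn S)
    (hmin : ∀ e ∈ S, ¬ r.Conn (S.erase e)) :
    #S = 1 ∨ (r S = 2 ∧ #S = 3) ∨ (#S : ℤ) ≤ 2 * r S - 2 := by
  induction hn : #S using Nat.strong_induction_on generalizing r S with
  | _ n ih =>
  subst hn
  obtain ⟨e, he⟩ := h.1
  by_cases hne : (S.erase e).Nonempty
  swap
  · left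
    rw [not_nonempty_iff_eq_empty] at hne
    rw [← insert_erase he, hne]
    simp
  right
  obtain ⟨A, B, h1, h2, hA, hB, hle⟩ := exists_of_not_conn hne (hmin e he)
  rw [h.erase he hne] at hle
  have hs : r.Splits S e A B := ⟨h, by grind, by grind, by grind, h2, hA, hB, hle⟩
  have hcard : #S = 1 + #A + #B := by
    have k1 := card_of_split h1 h2
    have k2 := card_erase_add_one he
    omega
  -- Induction applies to `A` itself if `A` is connected, and otherwise to the summand on `insert e
  -- A`, which has the same rank and one more element. Adding the bounds for both parts and 1 for
  -- `e`, two single elements give the triangle, and all other cases the linear bound.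
  have key : ∀ A B : Finset α, r.Splits S e A B → #A < #S - 1 →
      (#A = 1 ∧ r A = 1) ∨ (#A : ℤ) ≤ 2 * r A - 2 := by
    intro A B hs hlt
    have hd := hs.disj
    have he1 := hs.notMem_left
    have he2 := hs.mem_iff
    by_cases h1 : #A = 1
    · left
      obtain ⟨a, rfl⟩ := card_eq_one.mp h1
      exact ⟨rfl, h.singleton (by grind) ⟨e, by grind⟩⟩
    right
    have hpos := card_pos.mpr hs.left
    have herase : ∀ f ∈ A, (A.erase f).Nonempty := fun f hf =>
      card_pos.mp (by rw [card_erase_of_mem hf]; omega)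
    have hdel : ∀ f ∈ A, ¬ (r.contract B).Conn ((insert e A).erase f) := fun f hf hc =>
      hmin f (by grind) (hs.conn_erase_of_conn_contract hf (herase f hf) hc)
    by_cases hcA : r.Conn A
    · rcases ih #A (by omega) hcA
        (fun f hf => hs.not_conn_erase hf (herase f hf) hcA (hdel f hf)) rfl with k | k | k
      · exact absurd k h1
      · obtain ⟨f, hf, hc⟩ := hs.exists_conn_erase hcA k.2 k.1
        exact absurd hc (hdel f hf)
      · exact k
    · have hci : #(insert e A) = #A + 1 := card_insert_of_notMem he1
      have q := ih #(insert e A) (by omega) hs.conn_contract (fun f hf => by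
        rcases mem_insert.mp hf with rfl | hf
        · rw [erase_insert he1]
          exact fun hc => hcA (hc.congr fun C hC => hs.contract_of_subset hC)
        · exact hdel f hf) rfl
      rw [hci, hs.contract_insert] at q
      push_cast at q
      omega
  have k1 := key A B hs (by have := card_pos.mpr hB; omega)
  have k2 := key B A hs.symm (by have := card_pos.mpr hA; omega)
  have k3 := hs.rank_eq
  rw [hcard]
  push_cast
  omega

end RankFunction

/-! ### Structure of minimally linked pairs -/

namespace RankFunction

open Finset
open scoped Classical

variable {α : Type*} {r r' : RankFunction α} {A B C D S T X F G K U I : Finset α} {e : α} {j : ℤ}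

theorem eq_card_of_erase_lt (h : ∀ e ∈ G, r (G.erase e) + 1 ≤ r G) : r G = #G := by
  refine le_antisymm (r.le_card G) ?_
  have key : ∀ A ⊆ G, (#A : ℤ) ≤ r A := by
    intro A
    induction A using Finset.induction_on with
    | empty => simp [r.map_empty]
    | insert e A he ih =>
      intro hA
      have k1 := ih (by grind)
      have k2 := h e (by grind)
      have k3 := r.submod_of_subset (insert e A) (G.erase e) (U := G) (I := A) (by grind) (by grind)
      rw [card_insert_of_notMem he]
      push_cast
      linarith
  exact key G subset_rfl

theorem union_eq_of_insert_le (h : ∀ f ∈ F, r (insert f G) ≤ r G) : r (F ∪ G) = r G := by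
  induction F using Finset.induction_on with
  | empty => simp
  | insert f F hf ih =>
    have k1 := ih (by grind)
    have k2 := h f (by grind)
    have k3 := r.submod_of_subset (F ∪ G) (insert f G) (U := insert f F ∪ G) (I := G)
      (by grind) (by grind)
    have k4 := r.mono (show G ⊆ insert f F ∪ G by grind)
    linarith

theorem Conn.contract_of_dual_erase (he : e ∈ G) (h : (r.dual G).Conn (G.erase e)) :
    (r.contract {e}).Conn (G.erase e) := by
  refine conn_of_lt h.1 fun A B h1 h2 hA hB => ?_
  have k := h.lt h1 h2 hA hB
  have hc := card_of_split h1 h2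
  simp only [dual_apply, contract_apply] at k ⊢
  rw [show G \ G.erase e = {e} by grind, show G \ A = B ∪ {e} by grind,
    show G \ B = A ∪ {e} by grind] at k
  rw [show G.erase e ∪ {e} = G by grind]
  linarith

/-- A linked pair no proper minor of which (of the form relevant here) is linked with the same
parameter. -/
structure MinimallyLinked (r : RankFunction α) (F G : Finset α) (j : ℤ) : Prop
    extends r.Linked F G j where
  one_le : 1 ≤ j
  eq_of_linked : ∀ X F' G', X ⊆ F ∪ G → F' ⊆ F ∪ G → G' ⊆ F ∪ G → (∀ x ∈ X, x ∉ F') →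
    (∀ x ∈ X, x ∉ G') → (r.contract X).Linked F' G' j → F' ∪ G' = F ∪ G

namespace MinimallyLinked

variable (h : r.MinimallyLinked F G j)
include h

theorem not_linked (hX : X ⊆ F ∪ G) {F' G' : Finset α} (hF' : F' ⊆ F) (hG' : G' ⊆ G)
    (hXF : ∀ x ∈ X, x ∉ F') (hXG : ∀ x ∈ X, x ∉ G') (he : e ∈ F ∪ G) (heF : e ∉ F')
    (heG : e ∉ G') : ¬ (r.contract X).Linked F' G' j := fun hl => by
  have := h.eq_of_linked X F' G' hX (hF'.trans subset_union_left) (hG'.trans subset_union_right)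
    hXF hXG hl
  rw [← this] at he
  simp [heF, heG] at he

/-- Otherwise `e`, which is skew to `F` because it is not a loop of the contraction of `F`, could be
contracted without losing connectivity. -/
theorem not_conn_contract_insert (he : e ∈ G) :
    ¬ (r.contract (F ∪ {e})).Conn (G.erase e) := by
  intro hc
  have hd := h.disj
  have q1 : r.contract F {e} = 1 := h.right.singleton he hc.1
  rw [contract_apply] at q1
  have q2 : ∀ D ⊆ F, r (D ∪ {e}) = r D + 1 := by
    intro D hD
    have k1 := r.submod_of_subset (D ∪ {e}) F (U := {e} ∪ F) (I := D) (by grind) (by grind)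
    have k2 := r.union_le_add_card D {e}
    rw [card_singleton] at k2
    push_cast at k2
    linarith
  have q3 : r {e} = 1 := by
    have := q2 ∅ (by simp)
    rwa [r.map_empty, empty_union, zero_add] at this
  refine h.not_linked (X := {e}) (F' := F) (G' := G.erase e) (e := e) (by grind) subset_rfl
    (erase_subset _ _) (by clear q2; grind) (by clear q2; grind) (by clear q2; grind)
    (by clear q2; grind) (by simp)
    ⟨h.left.congr fun D hD => ?_, ?_, by clear q2; grind, ?_⟩
  · rw [contract_apply, q2 D hD, q3]
    ring
  · rwa [contract_contract, union_comm]
  · simp only [contract_apply]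
    rw [q2 F subset_rfl, q3, show F ∪ G.erase e ∪ {e} = F ∪ G by clear q2; grind,
      show G.erase e ∪ {e} = G by clear q2; grind]
    linarith [h.le]

theorem conn_contract_erase (he : e ∈ G) (hn : (G.erase e).Nonempty) :
    (r.contract F).Conn (G.erase e) := by
  refine (h.right.erase_or_contract he hn).resolve_right ?_
  rw [contract_contract]
  exact h.not_conn_contract_insert he

theorem not_linked_erase_right (he : e ∈ G) : ¬ r.Linked F (G.erase e) j := by
  have hd := h.disj
  have := h.not_linked (X := ∅) (F' := F) (G' := G.erase e) (e := e) (by simp) subset_rfl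
    (erase_subset _ _) (by simp) (by simp) (by grind) (by grind) (by simp)
  rwa [contract_empty] at this

/-- An element of `G` spanned by the rest of `G` could be deleted. -/
theorem right_eq_card : r G = #G := by
  refine eq_card_of_erase_lt fun e he => ?_
  have hl := h.le
  by_cases hn : (G.erase e).Nonempty
  · by_contra! hlt
    refine h.not_linked_erase_right he ⟨h.left, h.conn_contract_erase he hn,
      fun x hx hx' => h.disj x hx (mem_of_mem_erase hx'), ?_⟩
    have := r.mono (show F ∪ G.erase e ⊆ F ∪ G by grind)
    linarith
  · rw [not_nonempty_iff_eq_empty] at hn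
    have k1 := r.mono (show F ⊆ F ∪ G by grind)
    rw [hn, r.map_empty]
    linarith [h.one_le]

/-- Otherwise `F.erase e` has the same closure as `F`, and `e` could be deleted. -/
theorem not_conn_erase (hf : e ∈ F) : ¬ r.Conn (F.erase e) := by
  intro hc
  have hd := h.disj
  have q1 := h.left.erase hf hc.1
  have := h.not_linked (X := ∅) (F' := F.erase e) (G' := G) (e := e) (by simp) (erase_subset _ _)
    subset_rfl (by simp) (by simp) (by grind) (by simp) (by grind)
  rw [contract_empty] at this
  refine this ⟨hc, h.right.congr fun D hD => ?_, by grind, ?_⟩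
  · rw [contract_apply, contract_apply, q1]
    have k1 := r.mono (show D ∪ F.erase e ⊆ D ∪ F by grind)
    have k2 := r.submod_of_subset (D ∪ F.erase e) F (U := D ∪ F) (I := F.erase e)
      (by grind) (by grind)
    linarith
  · have := r.mono (show F.erase e ∪ G ⊆ F ∪ G by grind)
    linarith [h.le]

/-- An element of `F` not spanned by `G` could be contracted: deleting it disconnects `F`, so
contracting it does not. -/
theorem union_eq_right : r (F ∪ G) = r G := by
  refine union_eq_of_insert_le fun f hf => ?_
  have hl := h.le
  have hd := h.disj
  by_cases hn : (F.erase f).Nonempty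
  · by_contra! hlt
    have hc := (h.left.erase_or_contract hf hn).resolve_left (h.not_conn_erase hf)
    refine h.not_linked (X := {f}) (F' := F.erase f) (G' := G) (e := f) (by grind)
      (erase_subset _ _) subset_rfl (by simp) (by grind) (by grind) (by simp) (by grind)
      ⟨hc, ?_, by grind, ?_⟩
    · rw [contract_contract, show {f} ∪ F.erase f = F by grind]
      exact h.right
    · have := r.singleton_le f
      simp only [contract_apply]
      rw [show F.erase f ∪ G ∪ {f} = F ∪ G by grind, show F.erase f ∪ {f} = F by grind,
        show G ∪ {f} = insert f G by grind]
      linarith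
  · rw [not_nonempty_iff_eq_empty] at hn
    have k1 := r.mono (show insert f G ⊆ F ∪ G by grind)
    have k2 := r.singleton_le f
    rw [show F = {f} by rw [← insert_erase hf, hn, insert_empty_eq]] at hl k1
    linarith [h.one_le]

/-- If the rank of `F` were larger, the connectivity could spare the one unit lost by deleting an
element of `G`. -/
theorem left_eq : r F = j := by
  have hl := h.le
  have h1 := h.union_eq_right
  have h2 := h.right_eq_card
  refine le_antisymm ?_ (by linarith)
  by_contra! hlt
  have h3 := r.mono (show F ⊆ F ∪ G by grind)
  have hpos := h.one_le
  have h4 : 1 < #G := by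
    have : (1 : ℤ) < #G := by linarith
    exact_mod_cast this
  obtain ⟨e, he⟩ := card_pos.mp (by omega : 0 < #G)
  refine h.not_linked_erase_right he ⟨h.left, h.conn_contract_erase he (card_pos.mp (by
    rw [card_erase_of_mem he]; omega)), fun x hx hx' => h.disj x hx (mem_of_mem_erase hx'), ?_⟩
  have := r.mono (show F ∪ G.erase e ⊆ F ∪ G by grind)
  have := r.le_erase_add_one G e
  linarith

theorem card_left : #F = 1 ∨ (j = 2 ∧ #F = 3) ∨ (#F : ℤ) ≤ 2 * j - 2 := by
  have := h.left.card_le_of_forall_not_conn_erase fun e he => h.not_conn_erase he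
  rwa [h.left_eq] at this

/-- The dual of the contraction of `F` restricted to `G` is minimally connected, of rank `#G - (#G -
j) = j`. -/
theorem card_right : #G = 1 ∨ (j = 2 ∧ #G = 3) ∨ (#G : ℤ) ≤ 2 * j - 2 := by
  have := h.right.dual.card_le_of_forall_not_conn_erase fun e he hc =>
    h.not_conn_contract_insert he (by
      rw [← contract_contract]
      exact hc.contract_of_dual_erase he)
  rwa [dual_apply, Finset.sdiff_self, map_empty, contract_apply, union_comm G F,
    h.union_eq_right, h.left_eq, h.right_eq_card, show (#G : ℤ) + 0 - (#G - j) = j by ring] at this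

end MinimallyLinked

/-! ### Transport along maps -/

section image

variable {β : Type*} {q : RankFunction β} {f : α → β}

theorem Conn.image (h : r.Conn S) (hr : ∀ A ⊆ S, q (A.image f) = r A) :
    q.Conn (S.image f) := by
  refine conn_of_lt (h.1.image f) fun A B h1 h2 hA hB => ?_
  have aux : ∀ A : Finset β, A ⊆ S.image f → ((S.filter fun x => f x ∈ A).image f) = A := by
    intro A hA
    ext y
    simp only [mem_image, mem_filter]
    constructor
    · rintro ⟨x, ⟨_, hx⟩, rfl⟩
      exact hx
    · intro hy
      obtain ⟨x, hx, rfl⟩ := mem_image.mp (hA hy)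
      exact ⟨x, ⟨hx, hy⟩, rfl⟩
  have hA' := aux A fun x hx => (h1 x).mpr (Or.inl hx)
  have hB' := aux B fun x hx => (h1 x).mpr (Or.inr hx)
  rw [← hA', ← hB', hr S subset_rfl, hr _ (filter_subset _ _), hr _ (filter_subset _ _)]
  refine h.lt (fun x => ?_) (fun x => ?_) ?_ ?_
  · simp only [mem_filter, ← and_or_left, ← h1]
    exact ⟨fun hx => ⟨hx, mem_image_of_mem f hx⟩, fun hx => hx.1⟩
  · simp only [mem_filter, not_and]
    exact fun hx _ => h2 _ hx.2
  · rw [← hA'] at hA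
    exact hA.of_image
  · rw [← hB'] at hB
    exact hB.of_image

theorem Linked.image (h : r.Linked F G j) (hr : ∀ A ⊆ F ∪ G, q (A.image f) = r A)
    (hf : Set.InjOn f ↑(F ∪ G)) : q.Linked (F.image f) (G.image f) j where
  left := h.left.image fun A hA => hr A (by grind)
  right := h.right.image (fun A hA => by
    rw [contract_apply, contract_apply, ← image_union, hr _ (by grind), hr _ (by grind)])
  disj := by
    intro x hx hx'
    obtain ⟨a, ha, rfl⟩ := mem_image.mp hx
    obtain ⟨b, hb, hab⟩ := mem_image.mp hx'
    have := hf (by simp [hb]) (by simp [ha]) hab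
    exact h.disj a ha (this ▸ hb)
  le := by
    rw [← image_union, hr _ subset_rfl, hr _ (by grind), hr _ (by grind)]
    exact h.le

/-- The minor of the matroid on `S` obtained by contracting `X` and restricting to `F ∪ G` has the
linked pair `F`, `G`. There is no condition on the pair if `j = 0`. -/
structure IsLink (r : RankFunction α) (S : Finset α) (j : ℕ) (X F G : Finset α) : Prop where
  contract_subset : X ⊆ S
  left_subset : F ⊆ S
  right_subset : G ⊆ S
  left_disj : ∀ x ∈ X, x ∉ F
  right_disj : ∀ x ∈ X, x ∉ G
  linked : j = 0 ∨ (r.contract X).Linked F G j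

theorem IsLink.image {j : ℕ} (h : r.IsLink S j X F G) (hr : ∀ A ⊆ S, q (A.image f) = r A)
    (hf : Set.InjOn f S) :
    q.IsLink (S.image f) j (X.image f) (F.image f) (G.image f) := by
  have h1 := h.contract_subset
  have h2 := h.left_subset
  have h3 := h.right_subset
  have hdisj : ∀ F ⊆ S, (∀ x ∈ X, x ∉ F) → ∀ x ∈ X.image f, x ∉ F.image f := by
    intro F hF hd x hx hx'
    obtain ⟨a, ha, rfl⟩ := mem_image.mp hx
    obtain ⟨b, hb, hab⟩ := mem_image.mp hx'
    have := hf (hF hb) (h1 ha) hab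
    exact hd a ha (this ▸ hb)
  refine ⟨image_subset_image h1, image_subset_image h2, image_subset_image h3,
    hdisj F h2 h.left_disj, hdisj G h3 h.right_disj, h.linked.imp_right fun hl => ?_⟩
  refine hl.image (fun A hA => ?_) (hf.mono (by
    rw [coe_subset]; exact union_subset h2 h3))
  rw [contract_apply, contract_apply, ← image_union, hr _ h1, hr]
  exact union_subset (hA.trans (union_subset h2 h3)) h1

end image

end RankFunction

/-! ### Bases, exchanges and weights -/

namespace RankFunction

open Finset
open scoped Classical

variable {α : Type*} {r r' : RankFunction α} {A B C D S T X Y Z F G K U I B' : Finset α}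
  {e f : α} {j : ℤ} {c : α → ℝ} {δ : ℝ}

/-- `B` is a basis of the set `S`. -/
structure IsBase (r : RankFunction α) (S B : Finset α) : Prop where
  subset : B ⊆ S
  indep : r B = #B
  rank_eq : r S = #B

theorem indep_mono (h : r B = #B) (hA : A ⊆ B) : r A = #A := by
  refine le_antisymm (r.le_card A) ?_
  have k1 := r.union_le (C := B) (A := A) (B := B \ A) (by grind)
  have k2 := r.le_card (B \ A)
  have k3 := card_of_split (U := B) (A := A) (B := B \ A) (by grind) (by grind)
  linarith

theorem IsBase.indep_inter (h : r.IsBase S B) (A : Finset α) : r (B ∩ A) = #(B ∩ A) :=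
  indep_mono h.indep inter_subset_left

theorem IsBase.card_inter_le (h : r.IsBase S B) (A : Finset α) : (#(B ∩ A) : ℤ) ≤ r A := by
  rw [← h.indep_inter]
  exact r.mono inter_subset_right

theorem exists_lt_insert (h : r A < r T) : ∃ f ∈ T, r A < r (insert f A) := by
  by_contra! hc
  have h1 := union_eq_of_insert_le hc
  have h2 := r.mono (show T ⊆ T ∪ A by grind)
  linarith

theorem exists_isBase_superset (hI : r I = #I) (hT : I ⊆ T) : ∃ B, I ⊆ B ∧ r.IsBase T B := by
  obtain ⟨B, hIB, hB, hmax⟩ := exists_le_maximal (a := I)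
    (T.powerset.filter fun B => r B = #B) (by simp [hT, hI])
  simp only [mem_filter, mem_powerset] at hB hmax
  refine ⟨B, hIB, hB.1, hB.2, ?_⟩
  rw [← hB.2]
  refine le_antisymm ?_ (r.mono hB.1)
  by_contra! hc
  obtain ⟨f, hf, hlt⟩ := exists_lt_insert hc
  have hfB : f ∉ B := fun h => by simp [h] at hlt
  have k1 := r.le_card (insert f B)
  have k2 := card_insert_of_notMem hfB
  have k3 := hB.2
  have := hmax ⟨insert_subset hf hB.1, by omega⟩ (subset_insert f B)
  exact hfB (this (mem_insert_self f B))

theorem exists_isBase_inter (hYZ : Y ⊆ Z) (hZ : Z ⊆ S) :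
    ∃ B, r.IsBase S B ∧ (#(B ∩ Y) : ℤ) = r Y ∧ (#(B ∩ Z) : ℤ) = r Z := by
  obtain ⟨I, -, hI⟩ := exists_isBase_superset (r := r) (I := ∅) (T := Y) (by simp [r.map_empty])
    (by simp)
  obtain ⟨J, hIJ, hJ⟩ := exists_isBase_superset hI.indep (hI.subset.trans hYZ)
  obtain ⟨B, hJB, hB⟩ := exists_isBase_superset hJ.indep (hJ.subset.trans hZ)
  refine ⟨B, hB, le_antisymm (hB.card_inter_le Y) ?_, le_antisymm (hB.card_inter_le Z) ?_⟩
  · rw [hI.rank_eq]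
    exact_mod_cast card_le_card (subset_inter (hIJ.trans hJB) hI.subset)
  · rw [hJ.rank_eq]
    exact_mod_cast card_le_card (subset_inter hJB hJ.subset)

theorem card_insert_erase (he : e ∈ B) (hf : f ∉ B) : #(insert f (B.erase e)) = #B := by
  rw [card_insert_of_notMem (by grind), card_erase_add_one he]

theorem IsBase.insert_erase (hB : r.IsBase S B) (he : e ∈ B) (hf : f ∉ B) (hfS : f ∈ S)
    (hlt : r (B.erase e) < r (insert f (B.erase e))) : r.IsBase S (insert f (B.erase e)) := by
  have h1 := card_insert_erase he hf
  have h2 := indep_mono hB.indep (erase_subset e B)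
  have h3 := card_erase_add_one he
  have h4 := r.le_card (insert f (B.erase e))
  have h5 := hB.subset
  refine ⟨by grind, by omega, by rw [hB.rank_eq, h1]⟩

theorem IsBase.exchange (hB : r.IsBase S B) (hB' : r.IsBase S B') (he : e ∈ B) (he' : e ∉ B') :
    ∃ f ∈ B', f ∉ B ∧ r.IsBase S (insert f (B.erase e)) := by
  have h2 := indep_mono hB.indep (erase_subset e B)
  have h3 := card_erase_add_one he
  have h4 : #B = #B' := by exact_mod_cast hB.rank_eq.symm.trans hB'.rank_eq
  have h5 := hB'.indep
  obtain ⟨f, hf, hlt⟩ := exists_lt_insert (r := r) (A := B.erase e) (T := B') (by omega)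
  have hfB : f ∉ B := by
    intro hfB
    have : f ≠ e := by rintro rfl; exact he' hf
    simp [hfB, this] at hlt
  exact ⟨f, hf, hfB, hB.insert_erase he hfB (hB'.subset hf) hlt⟩

/-- Two bases on different sides of a property can be chosen adjacent. -/
theorem IsBase.exists_adjacent {P : Finset α → Prop} (hB : r.IsBase S B) (hB' : r.IsBase S B')
    (hP : P B) (hP' : ¬ P B') : ∃ C e f, r.IsBase S C ∧ P C ∧ e ∈ C ∧ f ∉ C ∧
      r.IsBase S (insert f (C.erase e)) ∧ ¬ P (insert f (C.erase e)) := by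
  induction hn : #(B \ B') generalizing B with
  | zero =>
    have h4 : #B = #B' := by exact_mod_cast hB.rank_eq.symm.trans hB'.rank_eq
    have : B ⊆ B' := by simpa using hn
    have := eq_of_subset_of_card_le this h4.ge
    exact absurd (this ▸ hP) hP'
  | succ n ih =>
    obtain ⟨e, he⟩ := card_pos.mp (by omega : 0 < #(B \ B'))
    rw [mem_sdiff] at he
    obtain ⟨f, hf, hfB, hbase⟩ := hB.exchange hB' he.1 he.2
    by_cases hPC : P (insert f (B.erase e))
    · refine ih hbase hPC ?_
      rw [show insert f (B.erase e) \ B' = (B \ B').erase e by grind,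
        card_erase_of_mem (mem_sdiff.mpr he), hn]
      rfl
    · exact ⟨B, e, f, hB, hP, he.1, hfB, hbase, hPC⟩

theorem IsBase.exists_exchange (hB : r.IsBase S B) (hYZ : Y ⊆ Z) (hZS : Z ⊆ S)
    (hZ : r Z ≤ #(B ∩ Z)) (hY : #(B ∩ Y) < r Y) :
    ∃ f ∈ Y, f ∉ B ∧ ∃ e ∈ B, e ∈ Z ∧ e ∉ Y ∧ r.IsBase S (insert f (B.erase e)) := by
  rw [← hB.indep_inter] at hY
  obtain ⟨f, hf, hlt⟩ := exists_lt_insert hY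
  have hfB : f ∉ B := fun h => by
    rw [insert_eq_of_mem (mem_inter.mpr ⟨h, hf⟩)] at hlt
    exact lt_irrefl _ hlt
  refine ⟨f, hf, hfB, ?_⟩
  by_contra! hc
  have hc' : ∀ e ∈ B, e ∈ Z → e ∉ Y → r (insert f (B.erase e)) ≤ r (B.erase e) := by
    intro e h1 h2 h3
    by_contra! hlt
    exact hc e h1 h2 h3 (hB.insert_erase h1 hfB (hZS (hYZ hf)) hlt)
  clear hc
  -- If no exchange works, `f` is spanned by every `B.erase e` with `e ∈ (B ∩ Z) \ Y`. Spans of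
  -- subsets of an independent set intersect in the span of the intersection, so `f` would be
  -- spanned by `B ∩ Y`.
  have key : ∀ T ⊆ (B ∩ Z) \ Y, r (insert f ((B ∩ Z) \ T)) ≤ r ((B ∩ Z) \ T) := by
    intro T
    induction T using Finset.induction_on with
    | empty =>
      intro _
      rw [sdiff_empty, hB.indep_inter]
      exact (r.mono (by grind)).trans hZ
    | insert e T he ih =>
      intro hT
      have k1 := ih (by grind)
      have k2 := hc' e (by grind) (by grind) (by grind)
      clear ih hc'
      have k3 := r.submod_of_subset (insert f ((B ∩ Z) \ T)) (insert f (B.erase e))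
        (U := (B ∩ Z) \ T ∪ B.erase e) (I := insert f ((B ∩ Z) \ insert e T)) (by grind) (by grind)
      have e1 := indep_mono (A := (B ∩ Z) \ T ∪ B.erase e) hB.indep (by grind)
      have e2 := indep_mono (A := (B ∩ Z) \ T) hB.indep (by grind)
      have e3 := indep_mono (A := B.erase e) hB.indep (by grind)
      have e4 := indep_mono (A := (B ∩ Z) \ insert e T) hB.indep (by grind)
      have e5 := card_union_add_card_inter ((B ∩ Z) \ T) (B.erase e)
      have e6 : (B ∩ Z) \ T ∩ B.erase e = (B ∩ Z) \ insert e T := by grind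
      rw [e6] at e5
      omega
  have := key _ subset_rfl
  rw [show (B ∩ Z) \ ((B ∩ Z) \ Y) = B ∩ Y by clear key hc'; grind] at this
  linarith

theorem IsBase.card_inter_eq (hB : r.IsBase S B) (hsep : r K + r (S \ K) ≤ r S) :
    (#(B ∩ K) : ℤ) = r K ∧ (#(B ∩ (S \ K)) : ℤ) = r (S \ K) := by
  have h1 := hB.card_inter_le K
  have h2 := hB.card_inter_le (S \ K)
  have h3 := hB.subset
  have h4 := card_of_split (U := B) (A := B ∩ K) (B := B ∩ (S \ K)) (by grind) (by grind)
  have h5 := hB.rank_eq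
  constructor <;> linarith

theorem sum_insert_erase (he : e ∈ B) (hf : f ∉ B) (c : α → ℝ) :
    ∑ x ∈ insert f (B.erase e), c x = ∑ x ∈ B, c x + (c f - c e) := by
  rw [sum_insert (by grind), ← add_sum_erase B c he]
  ring

theorem card_inter_add_card_inter (B : Finset α) (C D : Finset α) (hd : ∀ x ∈ C, x ∉ D) :
    (#(B ∩ (C ∪ D)) : ℤ) = #(B ∩ C) + #(B ∩ D) :=
  card_of_split (by grind) (by grind)

section weights

variable (hK : F ∪ G ⊆ S) (hsep : r (F ∪ G) + r (S \ (F ∪ G)) ≤ r S) (hl : r.Linked F G j)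
  (hc : ∀ B B', r.IsBase S B → r.IsBase S B' → (#(B ∩ F) : ℤ) = r F → (#(B' ∩ F) : ℤ) = r F →
    ∑ x ∈ B, c x = ∑ x ∈ B', c x)
include hc

/-- Otherwise an exchange would raise the weight strictly while the base still spans `F`. -/
theorem card_inter_level_eq (hFS : F ⊆ S) (hB : r.IsBase S B) (hBF : (#(B ∩ F) : ℤ) = r F)
    (t : ℝ) :
    r (F.filter fun x => t ≤ c x) = #(B ∩ F.filter fun x => t ≤ c x) ∧
      r (F ∪ S.filter fun x => t ≤ c x) = #(B ∩ (F ∪ S.filter fun x => t ≤ c x)) := by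
  constructor
  · refine le_antisymm ?_ (hB.card_inter_le _)
    by_contra! hlt
    obtain ⟨f, hf, hfB, e, he, heZ, heY, hb⟩ := hB.exists_exchange (filter_subset _ F) hFS
      hBF.ge hlt
    simp only [mem_filter] at hf heY
    have k := hc _ _ hb hB (by
      rw [← hBF, show insert f (B.erase e) ∩ F = insert f ((B ∩ F).erase e) by grind,
        card_insert_erase (by grind) (by grind)]) hBF
    rw [sum_insert_erase he hfB] at k
    have : c e < t := by by_contra! h; exact heY ⟨heZ, h⟩
    linarith [hf.2]
  · refine le_antisymm ?_ (hB.card_inter_le _)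
    by_contra! hlt
    obtain ⟨f, hf, hfB, e, he, heZ, heY, hb⟩ := hB.exists_exchange
      (union_subset hFS (filter_subset _ S)) subset_rfl (by
        rw [inter_eq_left.mpr hB.subset, hB.rank_eq]) hlt
    simp only [mem_union, mem_filter, not_or] at hf heY
    have hfF : f ∉ F := by
      intro hfF
      have k1 := hB.indep_inter F
      have k2 : r (insert f (B ∩ F)) = r (B ∩ F) := by
        refine le_antisymm ?_ (r.le_insert _ _)
        rw [k1, hBF]
        exact r.mono (by grind)
      have k3 := hb.indep
      have k4 := indep_mono (A := insert f (B ∩ F)) k3 (by grind)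
      rw [card_insert_of_notMem (by grind)] at k4
      push_cast at k4
      linarith
    have k := hc _ _ hb hB (by
      rw [← hBF, show insert f (B.erase e) ∩ F = B ∩ F by grind]) hBF
    rw [sum_insert_erase he hfB] at k
    have : c e < t := by by_contra! h; exact heY.2 ⟨heZ, h⟩
    have := (hf.resolve_left hfF).2
    linarith

include hK hl

/-- A base that spans `F` also spans each superlevel set of `c` in `F`. Choosing it to span the
complement in `F` too would separate `F` at a proper superlevel set. -/
theorem weight_eq_left {x y : α} (hx : x ∈ F) (hy : y ∈ F) : c x = c y := by
  have key : ∀ x ∈ F, ∀ y ∈ F, ¬ c x < c y := by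
    intro x hx y hy hlt
    obtain ⟨B, hB, h1, h2⟩ := exists_isBase_inter (r := r) (Y := F \ F.filter fun x => c y ≤ c x)
      (Z := F) (S := S) sdiff_subset (union_subset_left hK)
    have h3 := (card_inter_level_eq hc (union_subset_left hK) hB h2 (c y)).1
    have h4 := hl.left.2 (F.filter fun x => c y ≤ c x) (filter_subset _ _)
      ⟨y, by simp [hy]⟩ (fun h => by
        have : x ∈ F.filter fun x => c y ≤ c x := by rw [h]; exact hx
        rw [mem_filter] at this
        linarith)
    have h5 := card_inter_add_card_inter B (F.filter fun x => c y ≤ c x)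
      (F \ F.filter fun x => c y ≤ c x) (by grind)
    rw [union_sdiff_of_subset (filter_subset _ _)] at h5
    linarith
  exact le_antisymm (not_lt.mp (key y hy x hx)) (not_lt.mp (key x hx y hy))

include hsep

theorem weight_eq_right {x y : α} (hx : x ∈ G) (hy : y ∈ G) : c x = c y := by
  have hd := hl.disj
  have key : ∀ x ∈ G, ∀ y ∈ G, ¬ c x < c y := by
    intro x hx y hy hlt
    set A := S.filter fun x => c y ≤ c x with hA
    have hxA : x ∉ A := by simp [hA, hlt]
    have hyA : y ∈ A := by
      rw [hA, mem_filter]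
      exact ⟨hK (mem_union_right _ hy), le_rfl⟩
    have hAS : A ⊆ S := filter_subset _ _
    have hFS : F ⊆ S := union_subset_left hK
    obtain ⟨B, hB, h1, h2⟩ := exists_isBase_inter (r := r) (Y := F) (Z := F ∪ (G \ A)) (S := S)
      (by grind) (by grind)
    have h3 := (card_inter_level_eq hc hFS hB h1 (c y)).2
    rw [← hA] at h3
    clear_value A
    clear hc hA
    have h4 := hl.right.lt (A := G ∩ A) (B := G \ A) (by grind) (by grind) ⟨y, by grind⟩
      ⟨x, by grind⟩
    simp only [contract_apply] at h4
    have h5 := eq_inter_add_sdiff hK hsep (T := F ∪ A) (by grind)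
    have h6 := hB.card_inter_le ((F ∪ A) ∩ (F ∪ G))
    have h7 := hB.card_inter_le ((F ∪ A) \ (F ∪ G))
    have h8 := card_inter_add_card_inter B ((F ∪ A) ∩ (F ∪ G)) ((F ∪ A) \ (F ∪ G)) (by grind)
    rw [show (F ∪ A) ∩ (F ∪ G) ∪ (F ∪ A) \ (F ∪ G) = F ∪ A by grind] at h8
    have h9 := card_inter_add_card_inter B ((F ∪ A) ∩ (F ∪ G)) (G \ A) (by grind)
    rw [show (F ∪ A) ∩ (F ∪ G) ∪ G \ A = F ∪ G by grind] at h9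
    have h10 := card_inter_add_card_inter B F (G \ A) (by grind)
    have h11 := hB.card_inter_le (F ∪ G)
    rw [show G ∪ F = F ∪ G by grind, show G ∩ A ∪ F = (F ∪ A) ∩ (F ∪ G) by grind,
      show G \ A ∪ F = F ∪ G \ A by grind] at h4
    linarith
  exact le_antisymm (not_lt.mp (key y hy x hx)) (not_lt.mp (key x hx y hy))

/-- A weight that is constant on the bases that span `F` depends on `#(B ∩ F)` only. -/
theorem exists_weight_eq :
    ∃ κ s : ℝ, ∀ B, r.IsBase S B → ∑ x ∈ B, c x = κ + s * (r F - #(B ∩ F)) := by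
  have hd := hl.disj
  have hFS : F ⊆ S := union_subset_left hK
  obtain ⟨a, ha⟩ := hl.left.1
  obtain ⟨b, hb⟩ := hl.right.1
  obtain ⟨B₀, hB₀, h1, -⟩ := exists_isBase_inter (r := r) (Y := F) (Z := F) subset_rfl hFS
  refine ⟨∑ x ∈ B₀, c x, c b - c a, fun B hB => ?_⟩
  have hF : ∀ B : Finset α, ∑ x ∈ B ∩ F, c x = #(B ∩ F) * c a := by
    intro B
    rw [← nsmul_eq_mul]
    refine sum_eq_card_nsmul fun x hx => ?_
    exact weight_eq_left hK hl hc (mem_of_mem_inter_right hx) ha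
  have hG : ∀ B : Finset α, ∑ x ∈ B ∩ G, c x = #(B ∩ G) * c b := by
    intro B
    rw [← nsmul_eq_mul]
    refine sum_eq_card_nsmul fun x hx => ?_
    exact weight_eq_right hK hsep hl hc (mem_of_mem_inter_right hx) hb
  have hsum : ∀ B, r.IsBase S B → ∑ x ∈ B, c x =
      r F * c a + (r (F ∪ G) - r F) * c b + ∑ x ∈ B ∩ (S \ (F ∪ G)), c x
        + (c b - c a) * (r F - #(B ∩ F)) := by
    intro B hB
    have k1 := (hB.card_inter_eq hsep).1
    have k2 := card_inter_add_card_inter B F G hd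
    have hsub := hB.subset
    have k3 : B = (B ∩ F ∪ B ∩ G) ∪ B ∩ (S \ (F ∪ G)) := by clear hc hF hG; grind
    have k4 : ∑ x ∈ B, c x =
        ∑ x ∈ B ∩ F, c x + ∑ x ∈ B ∩ G, c x + ∑ x ∈ B ∩ (S \ (F ∪ G)), c x := by
      conv_lhs => rw [k3]
      rw [sum_union (disjoint_left.mpr (by clear hc hF hG; grind)),
        sum_union (disjoint_left.mpr (by clear hc hF hG; grind))]
    have k5 : ((#(B ∩ G) : ℤ) : ℝ) = ((r (F ∪ G) - #(B ∩ F) : ℤ) : ℝ) := by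
      congr 1
      linarith
    push_cast at k5
    rw [k4, hF, hG, k5]
    ring
  have hK0 := hB₀.card_inter_eq hsep
  have hK1 := hB.card_inter_eq hsep
  -- A base that spans `F` and agrees with `B` off the component; comparison with `B₀` shows that
  -- the weight off the component is the same for all bases.
  set B₁ := B₀ ∩ (F ∪ G) ∪ B ∩ (S \ (F ∪ G)) with hB₁
  have hs1 := hB.subset
  have hs2 := hB₀.subset
  have e1 : B₁ ∩ (F ∪ G) = B₀ ∩ (F ∪ G) := by clear hc hF hG hsum; grind
  have e2 : B₁ \ (F ∪ G) = B ∩ (S \ (F ∪ G)) := by clear hc hF hG hsum; grind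
  have e3 : B₁ ∩ F = B₀ ∩ F := by clear hc hF hG hsum; grind
  have e4 : B₁ ∩ (S \ (F ∪ G)) = B ∩ (S \ (F ∪ G)) := by clear hc hF hG hsum; grind
  have e5 : B₁ ⊆ S := by clear hc hF hG hsum; grind
  have hcard : (#B₁ : ℤ) = r (F ∪ G) + r (S \ (F ∪ G)) := by
    rw [← hK0.1, ← hK1.2]
    exact card_of_split (by clear hc hF hG hsum; grind) (by clear hc hF hG hsum; grind)
  have hrank := eq_inter_add_sdiff hK hsep e5
  rw [e1, e2, hB₀.indep_inter, hB.indep_inter, hK0.1, hK1.2, ← hcard] at hrank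
  have hrS := eq_inter_add_sdiff hK hsep (T := S) subset_rfl
  rw [inter_eq_right.mpr hK, ← hcard] at hrS
  have hb₁ : r.IsBase S B₁ := ⟨e5, hrank, hrS⟩
  have k := hc B₁ B₀ hb₁ hB₀ (by rw [e3, h1]) h1
  have k1 := hsum B₁ hb₁
  rw [e3, e4, k] at k1
  rw [k1, hsum B hB]
  have k2 : ((#(B₀ ∩ F) : ℤ) : ℝ) = r F := by rw [h1]
  push_cast at k2
  rw [k2]
  ring

end weights

end RankFunction

/-! ### Facets come from linked pairs -/

namespace RankFunction

open Finset
open scoped Classical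

variable {α : Type*} {r r' : RankFunction α} {A B C D S T X Y Z F G K U I B' : Finset α}
  {e f : α} {j : ℤ} {c : α → ℝ} {δ : ℝ}

/-- Discrete intermediate values: `#(B ∩ F)` changes by at most 1 between adjacent bases, from a
base that spans `F` to one that spans `G` and `F ∪ G`. -/
theorem Linked.exists_isBase_card (hl : r.Linked F G j) (hK : F ∪ G ⊆ S) {i : ℤ} (hi : 0 ≤ i)
    (hij : i ≤ j) : ∃ B, r.IsBase S B ∧ (#(B ∩ F) : ℤ) = r F - i := by
  have hd := hl.disj
  have hle := hl.le
  obtain ⟨B₁, hB₁, h1, -⟩ := exists_isBase_inter (r := r) (Y := F) (Z := F) subset_rfl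
    (union_subset_left hK)
  obtain ⟨B₂, hB₂, h2, h3⟩ := exists_isBase_inter (r := r) (Y := G) (Z := F ∪ G)
    subset_union_right hK
  have h4 := card_inter_add_card_inter B₂ F G hd
  by_cases hP : r F - i ≤ #(B₂ ∩ F)
  · exact ⟨B₂, hB₂, by linarith⟩
  · obtain ⟨C, e, f, hC, hPC, he, hf, hC', hPC'⟩ := hB₁.exists_adjacent
      (P := fun B => r F - i ≤ #(B ∩ F)) hB₂ (by linarith) hP
    refine ⟨C, hC, le_antisymm ?_ hPC⟩
    have h5 : #(C ∩ F) ≤ #(insert e (insert f (C.erase e) ∩ F)) := card_le_card (by grind)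
    have h6 := card_insert_le e (insert f (C.erase e) ∩ F)
    omega

/-- The affine function with constant term `δ` and coefficients `c` is non-negative on the bases
of `S`, and its zeros are maximal among the sets of bases spanning some set `A`. -/
structure IsFacetWeight (r : RankFunction α) (S : Finset α) (δ : ℝ) (c : α → ℝ) : Prop where
  nonneg : ∀ B, r.IsBase S B → 0 ≤ δ + ∑ x ∈ B, c x
  exists_zero : ∃ B, r.IsBase S B ∧ δ + ∑ x ∈ B, c x = 0
  exists_ne : ∃ B, r.IsBase S B ∧ δ + ∑ x ∈ B, c x ≠ 0
  maximal : ∀ A ⊆ S, (∀ B, r.IsBase S B → δ + ∑ x ∈ B, c x = 0 → (#(B ∩ A) : ℤ) = r A) →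
    (∀ B, r.IsBase S B → (#(B ∩ A) : ℤ) = r A) ∨
      ∀ B, r.IsBase S B → (#(B ∩ A) : ℤ) = r A → δ + ∑ x ∈ B, c x = 0

/-- The zeros of the affine function are the bases that span `A`. -/
def IsZeroSet (r : RankFunction α) (S : Finset α) (δ : ℝ) (c : α → ℝ) (A : Finset α) : Prop :=
  A ⊆ S ∧ ∀ B, r.IsBase S B → (δ + ∑ x ∈ B, c x = 0 ↔ (#(B ∩ A) : ℤ) = r A)

namespace IsFacetWeight

variable (h : r.IsFacetWeight S δ c)
include h

theorem not_forall (hA : r.IsZeroSet S δ c A) : ¬ ∀ B, r.IsBase S B → (#(B ∩ A) : ℤ) = r A := by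
  intro hall
  obtain ⟨B, hB, hne⟩ := h.exists_ne
  exact hne ((hA.2 B hB).mpr (hall B hB))

theorem isZeroSet (hA : A ⊆ S)
    (h0 : ∀ B, r.IsBase S B → δ + ∑ x ∈ B, c x = 0 → (#(B ∩ A) : ℤ) = r A)
    (hne : ¬ ∀ B, r.IsBase S B → (#(B ∩ A) : ℤ) = r A) : r.IsZeroSet S δ c A :=
  ⟨hA, fun B hB => ⟨h0 B hB, ((h.maximal A hA h0).resolve_left hne) B hB⟩⟩

/-- Zeros are bases of minimum weight, so they span every sublevel set of `c`. At a swap of `e` for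
`f` that leaves the zeros, the sublevel set of `c e` is no longer spanned, and maximality applies to
it. -/
theorem exists_isZeroSet : ∃ A, r.IsZeroSet S δ c A := by
  obtain ⟨B₁, hB₁, h1⟩ := h.exists_zero
  obtain ⟨B₂, hB₂, h2⟩ := h.exists_ne
  obtain ⟨C, e, f, hC, hPC, he, hf, hC', hPC'⟩ := hB₁.exists_adjacent
    (P := fun B => δ + ∑ x ∈ B, c x = 0) hB₂ h1 h2
  have hpos := lt_of_le_of_ne (h.nonneg _ hC') (Ne.symm hPC')
  rw [sum_insert_erase he hf] at hpos
  have hlt : c e < c f := by linarith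
  set A := S.filter fun x => c x ≤ c e with hA
  have heA : e ∈ A := by
    rw [hA, mem_filter]
    exact ⟨hC.subset he, le_rfl⟩
  have hfA : f ∉ A := by simp [hA, hlt]
  have h0 : ∀ B, r.IsBase S B → δ + ∑ x ∈ B, c x = 0 → (#(B ∩ A) : ℤ) = r A := by
    intro B hB hB0
    refine le_antisymm (hB.card_inter_le _) ?_
    by_contra! hlt
    obtain ⟨f', hf', hfB, e', he', -, heY, hb⟩ := hB.exists_exchange (filter_subset _ S) subset_rfl
      (by rw [inter_eq_left.mpr hB.subset, hB.rank_eq]) hlt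
    have k := h.nonneg _ hb
    rw [sum_insert_erase he' hfB] at k
    have k1 : c f' ≤ c e := (mem_filter.mp hf').2
    have k2 : c e < c e' := by
      by_contra! hle
      exact heY (mem_filter.mpr ⟨hB.subset he', hle⟩)
    linarith
  refine ⟨A, h.isZeroSet (filter_subset _ S) h0 fun hall => ?_⟩
  have k1 := hall _ hC'
  have k2 := hall _ hC
  rw [show insert f (C.erase e) ∩ A = (C ∩ A).erase e by clear h0 hall; grind] at k1
  have k3 := card_erase_add_one (mem_inter.mpr ⟨he, heA⟩)
  omega

/-- A facet of a matroid base polytope comes from a linked pair covering a component. -/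
theorem exists_conn_isZeroSet :
    ∃ F G, r.IsZeroSet S δ c F ∧ F ∪ G ⊆ S ∧ r (F ∪ G) + r (S \ (F ∪ G)) ≤ r S ∧ r.Conn F ∧
      (r.contract F).Conn G ∧ ∀ x ∈ F, x ∉ G := by
  obtain ⟨A₀, hA₀⟩ := h.exists_isZeroSet
  obtain ⟨A, -, hA, hmin⟩ := exists_minimal_le_of_wellFoundedLT _ A₀ hA₀
  replace hmin : ∀ D ⊆ A, r.IsZeroSet S δ c D → A ⊆ D := fun D h1 h2 => hmin h2 h1
  have hnall := h.not_forall hA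
  have hAne : A.Nonempty := by
    rw [nonempty_iff_ne_empty]
    rintro rfl
    simp [r.map_empty] at hnall
  -- If `A` split, every zero would span both parts; by minimality neither is a zero set, so all
  -- bases would span both parts and hence `A`.
  have hAc : r.Conn A := by
    by_contra hc
    obtain ⟨D, D', h1, h2, hD, hD', hle⟩ := exists_of_not_conn hAne hc
    have hUA : A = D ∪ D' := by clear hnall hmin; grind
    have hsum : ∀ B, r.IsBase S B → (#(B ∩ A) : ℤ) = #(B ∩ D) + #(B ∩ D') := by
      intro B _
      rw [hUA]
      exact card_inter_add_card_inter B D D' h2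
    have key : ∀ D ⊆ A, D ≠ A →
        (∀ B, r.IsBase S B → (#(B ∩ A) : ℤ) = r A → (#(B ∩ D) : ℤ) = r D) →
        ∀ B, r.IsBase S B → (#(B ∩ D) : ℤ) = r D := by
      intro D hDA hne hW
      by_contra hall
      have := h.isZeroSet (hDA.trans hA.1) (fun B hB h0 => hW B hB ((hA.2 B hB).mp h0)) hall
      exact hne (hDA.antisymm (hmin D hDA this))
    have k1 := key D (by rw [hUA]; exact subset_union_left) (by
      rintro rfl
      obtain ⟨x, hx⟩ := hD'
      exact h2 x ((h1 x).mpr (Or.inr hx)) hx) (fun B hB hBA => by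
        have := hsum B hB
        have := hB.card_inter_le D
        have := hB.card_inter_le D'
        linarith)
    have k2 := key D' (by rw [hUA]; exact subset_union_right) (by
      rintro rfl
      obtain ⟨x, hx⟩ := hD
      exact h2 x hx ((h1 x).mpr (Or.inl hx))) (fun B hB hBA => by
        have := hsum B hB
        have := hB.card_inter_le D
        have := hB.card_inter_le D'
        linarith)
    refine hnall fun B hB => ?_
    have := hsum B hB
    have := k1 B hB
    have := k2 B hB
    have := r.union_le (C := A) (A := D) (B := D') (by rw [hUA])
    linarith
  clear hmin
  have hAc' := hAc
  rw [← contract_empty r] at hAc'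
  obtain ⟨K, hAK, hKS, hK, hsep⟩ := RankFunction.exists_component hAc' hA.1 (empty_subset S)
  have hU : A ∪ K \ A = K := union_sdiff_of_subset hAK
  refine ⟨A, K \ A, hA, by rwa [hU], by rwa [hU], hAc, ?_, by simp +contextual⟩
  have hGne : (K \ A).Nonempty := by
    rw [sdiff_nonempty]
    intro hKA
    obtain rfl := hAK.antisymm hKA
    exact hnall fun B hB => (hB.card_inter_eq hsep).1
  -- If `G` split into `D₁`, `D₂`, every zero would span `A ∪ D₁`. By maximality either all bases
  -- span it, which separates `K`, or all bases that span it span `A`, which separates `A ∪ D₁`.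
  by_contra hc
  obtain ⟨D₁, D₂, h1, h2, hD₁, hD₂, hle⟩ := exists_of_not_conn hGne hc
  simp only [contract_apply] at hle
  rw [union_comm (K \ A) A, hU, union_comm D₁, union_comm D₂] at hle
  have hconn : r.Conn (A ∪ D₁) := hK.union_of_contract_split hAc (A := D₂)
    (by clear hnall; grind) (by linarith)
  have hW : ∀ B, r.IsBase S B → δ + ∑ x ∈ B, c x = 0 → (#(B ∩ (A ∪ D₁)) : ℤ) = r (A ∪ D₁) := by
    intro B hB h0
    have k1 := (hA.2 B hB).mp h0
    have k2 := (hB.card_inter_eq hsep).1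
    have k3 := hB.card_inter_le (A ∪ D₁)
    have k4 := hB.card_inter_le (A ∪ D₂)
    have k5 := card_inter_add_card_inter B A D₁ (by clear hnall; grind)
    have k6 := card_inter_add_card_inter B A D₂ (by clear hnall; grind)
    have k7 := card_inter_add_card_inter B (A ∪ D₁) D₂ (by clear hnall; grind)
    rw [show A ∪ D₁ ∪ D₂ = K by clear hnall; grind] at k7
    linarith
  rcases h.maximal (A ∪ D₁) (by clear hnall hW; grind) hW with hall | hz
  · obtain ⟨B, hB, k1, k2⟩ := exists_isBase_inter (r := r) (Y := D₂) (Z := K) (S := S)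
      (by clear hnall hW; grind) hKS
    have k3 := hall B hB
    have k4 := card_inter_add_card_inter B (A ∪ D₁) D₂ (by clear hnall hW hall; grind)
    rw [show A ∪ D₁ ∪ D₂ = K by clear hnall hW hall; grind] at k4
    have k5 := hK.lt (A := A ∪ D₁) (B := D₂) (by clear hnall hW hall; grind)
      (by clear hnall hW hall; grind) hconn.1 hD₂
    linarith
  · obtain ⟨B, hB, k1, k2⟩ := exists_isBase_inter (r := r) (Y := D₁) (Z := A ∪ D₁) (S := S)
      subset_union_right (by clear hnall hW hz; grind)
    have k3 := (hA.2 B hB).mp (hz B hB k2)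
    have k4 := card_inter_add_card_inter B A D₁ (by clear hnall hW hz; grind)
    have k5 := hconn.lt (A := A) (B := D₁) (by clear hnall hW hz; grind)
      (by clear hnall hW hz; grind) hAc.1 hD₁
    linarith

/-- The function depends only on `#(B ∩ F)`, which ranges over at most one more integer than the
connectivity of the pair. -/
theorem exists_linked {j : ℕ}
    (hj : ∀ T : Finset ℝ, (∀ B, r.IsBase S B → δ + ∑ x ∈ B, c x ∈ T) → j < #T) :
    ∃ F G, F ∪ G ⊆ S ∧ r.Linked F G j := by
  obtain ⟨F, G, hF, hFG, hsep, hcF, hcG, hd⟩ := h.exists_conn_isZeroSet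
  have hl : r.Linked F G (r F + r G - r (F ∪ G)) := ⟨hcF, hcG, hd, by linarith⟩
  obtain ⟨κ, s, hks⟩ := exists_weight_eq (c := c) hFG hsep hl (fun B B' hB hB' h1 h2 => by
    have := (hF.2 B hB).mpr h1
    have := (hF.2 B' hB').mpr h2
    linarith)
  refine ⟨F, G, hFG, hcF, hcG, hd, ?_⟩
  have k := hj ((Icc (r (F ∪ G) - r G) (r F)).image fun i : ℤ => δ + (κ + s * (r F - i)))
    (fun B hB => by
      rw [mem_image]
      refine ⟨#(B ∩ F), ?_, by rw [hks B hB]; push_cast; rfl⟩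
      have k1 := hB.card_inter_le F
      have k2 := hB.card_inter_le G
      have k3 := (hB.card_inter_eq hsep).1
      have k4 := card_inter_add_card_inter B F G hd
      rw [mem_Icc]
      constructor <;> linarith)
  have k2 := k.trans_le card_image_le
  rw [Int.card_Icc] at k2
  omega

end IsFacetWeight

end RankFunction

/-! ### From matroids and base configurations to rank functions -/

namespace MatroidLevel

open Finset
open scoped Classical

variable {α : Type*} {M : Matroid α}

theorem eRk_coe_ne_top (M : Matroid α) (A : Finset α) : M.eRk (A : Set α) ≠ ⊤ :=
  ((M.eRk_le_encard _).trans_lt (by simp)).ne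

/-- The rank function of a matroid, on finite sets. -/
noncomputable def rankFunction (M : Matroid α) : RankFunction α where
  toFun A := ((M.eRk (A : Set α)).toNat : ℤ)
  map_empty := by simp
  le_insert e A := by
    have := M.eRk_mono (show (A : Set α) ⊆ ((insert e A : Finset α) : Set α) by simp)
    exact_mod_cast ENat.toNat_le_toNat this (eRk_coe_ne_top M _)
  insert_le e A := by
    have h := M.eRk_insert_le_add_one e (A : Set α)
    rw [← coe_insert] at h
    have h2 := ENat.toNat_le_toNat h (by simp)
    rw [ENat.toNat_add (eRk_coe_ne_top M _) (by simp)] at h2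
    exact_mod_cast h2
  submod A B := by
    have h := M.eRk_inter_add_eRk_union_le (A : Set α) (B : Set α)
    rw [← coe_inter, ← coe_union] at h
    have h2 := ENat.toNat_le_toNat h (by simp)
    rw [ENat.toNat_add (eRk_coe_ne_top M _) (eRk_coe_ne_top M _),
      ENat.toNat_add (eRk_coe_ne_top M _) (eRk_coe_ne_top M _)] at h2
    rw [add_comm (M.eRk _).toNat] at h2
    exact_mod_cast h2

theorem rankFunction_apply (M : Matroid α) (A : Finset α) :
    rankFunction M A = ((M.eRk (A : Set α)).toNat : ℤ) := rfl

theorem rankFunction_eq_iff (M : Matroid α) (A : Finset α) (n : ℕ) :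
    rankFunction M A = n ↔ M.eRk (A : Set α) = n := by
  rw [rankFunction_apply, Nat.cast_inj, ← ENat.natCast_toNat (eRk_coe_ne_top M A)]
  simp

/-- The ground set of a finite matroid as a `Finset`. -/
noncomputable def groundFinset (M : Matroid α) [M.Finite] : Finset α := M.ground_finite.toFinset

@[simp] theorem coe_groundFinset (M : Matroid α) [M.Finite] : (groundFinset M : Set α) = M.E := by
  simp [groundFinset]

@[simp] theorem mem_groundFinset [M.Finite] {x : α} : x ∈ groundFinset M ↔ x ∈ M.E := by
  simp [groundFinset]

theorem isBase_iff [M.Finite] (B : Finset α) :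
    (rankFunction M).IsBase (groundFinset M) B ↔ M.IsBase (B : Set α) := by
  constructor
  · rintro ⟨h1, h2, h3⟩
    rw [rankFunction_eq_iff] at h2 h3
    rw [coe_groundFinset, M.eRk_ground] at h3
    have hI : M.Indep (B : Set α) := by
      rw [M.indep_iff_eRk_eq_encard_of_finite B.finite_toSet, h2]
      simp
    exact hI.isBase_of_eRk_ge B.finite_toSet (by rw [h2, h3])
  · intro h
    refine ⟨fun x hx => mem_groundFinset.mpr (h.subset_ground hx), ?_, ?_⟩
    · rw [rankFunction_eq_iff, h.indep.eRk_eq_encard]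
      simp
    · rw [rankFunction_eq_iff, coe_groundFinset, M.eRk_ground, ← h.encard_eq_eRank]
      simp

/-- The characteristic vector of a finite set. -/
noncomputable def charVec (M : Matroid α) (B : Finset α) : M.E → ℝ :=
  fun e => if (e : α) ∈ B then 1 else 0

theorem mem_baseConfiguration [M.Finite] {x : M.E → ℝ} :
    x ∈ baseConfiguration M ↔
      ∃ B, (rankFunction M).IsBase (groundFinset M) B ∧ x = charVec M B := by
  constructor
  · rintro ⟨B, hB, hx⟩
    refine ⟨(M.ground_finite.subset hB.subset_ground).toFinset, ?_, ?_⟩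
    · rw [isBase_iff]
      simpa using hB
    · ext e
      simp [hx, charVec, Set.indicator_apply]
  · rintro ⟨B, hB, rfl⟩
    refine ⟨B, (isBase_iff B).mp hB, fun e => ?_⟩
    simp [charVec, Set.indicator_apply]

theorem charVec_mem [M.Finite] {B : Finset α}
    (hB : (rankFunction M).IsBase (groundFinset M) B) : charVec M B ∈ baseConfiguration M :=
  mem_baseConfiguration.mpr ⟨B, hB, rfl⟩

/-- The coefficients of an affine function, extended by zero. -/
noncomputable def coeff (ℓ : (M.E → ℝ) →ᵃ[ℝ] ℝ) (x : α) : ℝ :=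
  if h : x ∈ M.E then ℓ.linear (fun e => if (⟨x, h⟩ : M.E) = e then 1 else 0) else 0

theorem sum_charVec [M.Finite] [Fintype M.E] {B : Finset α} (hB : B ⊆ groundFinset M)
    (c : α → ℝ) : ∑ e : M.E, charVec M B e * c e = ∑ x ∈ B, c x := by
  have h1 : ∑ e : M.E, charVec M B e * c e = ∑ x ∈ groundFinset M, if x ∈ B then c x else 0 := by
    rw [← sum_coe_sort (groundFinset M)]
    refine Fintype.sum_equiv (Equiv.subtypeEquivRight fun x => mem_groundFinset.symm) _ _ ?_
    intro e
    simp [charVec]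
  rw [h1, sum_ite_mem, inter_eq_right.mpr hB]

theorem apply_charVec [M.Finite] (ℓ : (M.E → ℝ) →ᵃ[ℝ] ℝ) {B : Finset α}
    (hB : (rankFunction M).IsBase (groundFinset M) B) :
    ℓ (charVec M B) = ℓ 0 + ∑ x ∈ B, coeff ℓ x := by
  have : Fintype M.E := M.ground_finite.fintype
  have h0 : ℓ (charVec M B) = ℓ.linear (charVec M B) + ℓ 0 := by
    simpa using congrFun ℓ.decomp (charVec M B)
  rw [← sum_charVec hB.subset, h0, LinearMap.pi_apply_eq_sum_univ ℓ.linear (charVec M B), add_comm]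
  simp [coeff]

theorem exists_affineMap [M.Finite] (δ : ℝ) (c : α → ℝ) : ∃ ℓ : (M.E → ℝ) →ᵃ[ℝ] ℝ,
    ∀ B, (rankFunction M).IsBase (groundFinset M) B → ℓ (charVec M B) = δ + ∑ x ∈ B, c x := by
  have : Fintype M.E := M.ground_finite.fintype
  refine ⟨AffineMap.const ℝ _ δ + (∑ e : M.E, c e • LinearMap.proj (R := ℝ) e).toAffineMap,
    fun B hB => ?_⟩
  rw [← sum_charVec hB.subset]
  simp [mul_comm]

theorem baseConfiguration_finite (M : Matroid α) [M.Finite] : (baseConfiguration M).Finite := by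
  refine ((groundFinset M).powerset.finite_toSet.image (charVec M)).subset ?_
  intro x hx
  obtain ⟨B, hB, rfl⟩ := mem_baseConfiguration.mp hx
  exact ⟨B, by rw [mem_coe, mem_powerset]; exact hB.subset, rfl⟩

theorem baseConfiguration_nonempty (M : Matroid α) : (baseConfiguration M).Nonempty := by
  obtain ⟨B, hB⟩ := M.exists_isBase
  exact ⟨_, B, hB, fun _ => rfl⟩

/-- The affine function `r A - ∑ x ∈ A, x` of a set `A`. -/
theorem exists_affineMap_rank [M.Finite] (A : Finset α) : ∃ ℓ : (M.E → ℝ) →ᵃ[ℝ] ℝ,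
    ∀ B, (rankFunction M).IsBase (groundFinset M) B →
      ℓ (charVec M B) = ((rankFunction M A - #(B ∩ A) : ℤ) : ℝ) := by
  obtain ⟨ℓ, hℓ⟩ := exists_affineMap (M := M) (rankFunction M A) (fun x => if x ∈ A then -1 else 0)
  refine ⟨ℓ, fun B hB => ?_⟩
  rw [hℓ B hB, sum_ite_mem]
  simp [sub_eq_add_neg]

theorem isFacetWeight_of_isFacetDefining [M.Finite] {ℓ : (M.E → ℝ) →ᵃ[ℝ] ℝ}
    (h : IsFacetDefining (baseConfiguration M) ℓ)
    (hne : ¬ (ℓ '' baseConfiguration M).encard ≤ 1) :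
    (rankFunction M).IsFacetWeight (groundFinset M) (ℓ 0) (coeff ℓ) := by
  obtain ⟨hnn, ⟨-, hneV⟩, hmax⟩ := h
  refine ⟨fun B hB => ?_, ?_, ?_, ?_⟩
  · rw [← apply_charVec ℓ hB]
    exact hnn _ (charVec_mem hB)
  -- If the facet were empty, subtracting the minimum of `ℓ` would give a nonempty face, which is
  -- proper because `ℓ` is not constant.
  · by_contra! hnz
    have hW : {v ∈ baseConfiguration M | ℓ v = 0} = ∅ := by
      rw [Set.eq_empty_iff_forall_notMem]
      rintro v ⟨hv, h0⟩
      obtain ⟨B, hB, rfl⟩ := mem_baseConfiguration.mp hv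
      rw [apply_charVec ℓ hB] at h0
      exact hnz B hB h0
    obtain ⟨v, hv, hmin⟩ := Set.exists_min_image _ ℓ (baseConfiguration_finite M)
      (baseConfiguration_nonempty M)
    have hU := hmax (y := {w ∈ baseConfiguration M | (ℓ - AffineMap.const ℝ (M.E → ℝ) (ℓ v) : (M.E → ℝ) →ᵃ[ℝ] ℝ) w = 0})
      ⟨⟨_, fun w hw => by simpa using hmin w hw, rfl⟩, fun hU => hne ?_⟩ (by rw [hW]; simp)
    · rw [hW] at hU
      exact hU (show v ∈ _ from ⟨hv, by simp⟩)
    · rw [Set.encard_le_one_iff]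
      rintro _ _ ⟨a, ha, rfl⟩ ⟨b, hb, rfl⟩
      rw [← hU] at ha hb
      have h1 := ha.2
      have h2 := hb.2
      simp only [AffineMap.coe_sub, Pi.sub_apply, AffineMap.const_apply] at h1 h2
      linarith
  · by_contra! hz
    refine hneV (Set.ext fun v => ⟨fun hv => hv.1, fun hv => ⟨hv, ?_⟩⟩)
    obtain ⟨B, hB, rfl⟩ := mem_baseConfiguration.mp hv
    rw [apply_charVec ℓ hB, hz B hB]
  · intro A hA hWA
    by_contra! hc
    obtain ⟨⟨B₁, hB₁, hne1⟩, B₂, hB₂, h2, hne2⟩ := hc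
    obtain ⟨ℓ', hℓ'⟩ := exists_affineMap_rank (M := M) A
    have hU := hmax (y := {w ∈ baseConfiguration M | ℓ' w = 0}) ⟨⟨ℓ', fun w hw => ?_, rfl⟩, ?_⟩ ?_
    · have : charVec M B₂ ∈ {w ∈ baseConfiguration M | ℓ' w = 0} :=
        ⟨charVec_mem hB₂, by rw [hℓ' B₂ hB₂, h2, sub_self, Int.cast_zero]⟩
      have := (hU this).2
      rw [apply_charVec ℓ hB₂] at this
      exact hne2 this
    · obtain ⟨B, hB, rfl⟩ := mem_baseConfiguration.mp hw
      rw [hℓ' B hB]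
      exact_mod_cast sub_nonneg.mpr (hB.card_inter_le A)
    · intro hU
      have hmem := charVec_mem hB₁
      rw [← hU] at hmem
      have h0 := hmem.2
      rw [hℓ' B₁ hB₁] at h0
      norm_cast at h0
      exact hne1 (by linarith)
    · rintro w ⟨hw, h0⟩
      refine ⟨hw, ?_⟩
      obtain ⟨B, hB, rfl⟩ := mem_baseConfiguration.mp hw
      rw [apply_charVec ℓ hB] at h0
      rw [hℓ' B hB, hWA B hB h0, sub_self, Int.cast_zero]

theorem exists_linked_of_not_isKLevel [M.Finite] {j : ℕ} (hj : 1 ≤ j)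
    (h : ¬ IsKLevel (baseConfiguration M) j) :
    ∃ F G, F ∪ G ⊆ groundFinset M ∧ (rankFunction M).Linked F G j := by
  unfold IsKLevel at h
  push Not at h
  obtain ⟨ℓ, hℓ, hcard⟩ := h
  refine (isFacetWeight_of_isFacetDefining hℓ fun hle => ?_).exists_linked fun T hT => ?_
  · have h1 : (1 : ℕ∞) ≤ j := by exact_mod_cast hj
    exact absurd (hcard.trans_le hle) (not_lt.mpr h1)
  · have hsub : ℓ '' baseConfiguration M ⊆ T := by
      rintro _ ⟨v, hv, rfl⟩
      obtain ⟨B, hB, rfl⟩ := mem_baseConfiguration.mp hv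
      rw [apply_charVec ℓ hB]
      exact hT B hB
    have := hcard.trans_le (Set.encard_le_encard hsub)
    rw [Set.encard_coe_eq_coe_finsetCard] at this
    exact_mod_cast this

/-- The function `r F - #(B ∩ F)` attains `0, …, j`. It defines a facet because, by
`exists_weight_eq`, any function that vanishes on its zeros is a multiple of it on the bases. -/
theorem not_isKLevel_of_linked [M.Finite] {j : ℕ} (hj : 1 ≤ j) {F G : Finset α}
    (hFG : F ∪ G ⊆ groundFinset M)
    (hsep : rankFunction M (F ∪ G) + rankFunction M (groundFinset M \ (F ∪ G)) ≤
      rankFunction M (groundFinset M))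
    (hl : (rankFunction M).Linked F G j) : ¬ IsKLevel (baseConfiguration M) j := by
  obtain ⟨ℓ, hℓ⟩ := exists_affineMap_rank (M := M) F
  have hspread : ∀ i : ℕ, i ≤ j → ∃ B, (rankFunction M).IsBase (groundFinset M) B ∧
      ℓ (charVec M B) = i := by
    intro i hi
    obtain ⟨B, hB, hBi⟩ := hl.exists_isBase_card hFG (i := i) (by omega) (by omega)
    refine ⟨B, hB, ?_⟩
    rw [hℓ B hB, hBi]
    push_cast
    ring
  have hnn : ∀ v ∈ baseConfiguration M, 0 ≤ ℓ v := by
    intro v hv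
    obtain ⟨B, hB, rfl⟩ := mem_baseConfiguration.mp hv
    rw [hℓ B hB]
    exact_mod_cast sub_nonneg.mpr (hB.card_inter_le F)
  have hzero : ∀ B, (rankFunction M).IsBase (groundFinset M) B →
      (ℓ (charVec M B) = 0 ↔ (#(B ∩ F) : ℤ) = rankFunction M F) := by
    intro B hB
    rw [hℓ B hB]
    norm_cast
    constructor <;> intro h <;> linarith
  intro hk
  have hcard := hk ℓ ⟨hnn, ⟨⟨ℓ, hnn, rfl⟩, ?_⟩, ?_⟩
  · have hsub : (((range (j + 1)).image fun i : ℕ => (i : ℝ) : Finset ℝ) : Set ℝ) ⊆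
        ℓ '' baseConfiguration M := by
      intro y hy
      simp only [coe_image, Set.mem_image, mem_coe, mem_range] at hy
      obtain ⟨i, hi, rfl⟩ := hy
      obtain ⟨B, hB, hBi⟩ := hspread i (by omega)
      exact ⟨_, charVec_mem hB, hBi⟩
    have h1 := (Set.encard_le_encard hsub).trans hcard
    rw [Set.encard_coe_eq_coe_finsetCard, card_image_of_injective _ Nat.cast_injective,
      card_range] at h1
    norm_cast at h1
    omega
  · intro hV
    obtain ⟨B, hB, hB1⟩ := hspread 1 hj
    have hmem := charVec_mem hB
    rw [← hV] at hmem
    have := hmem.2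
    rw [hB1] at this
    norm_num at this
  · rintro U ⟨⟨ℓ', hnn', rfl⟩, hneV⟩ hle v ⟨hv, h0⟩
    refine ⟨hv, ?_⟩
    have hW : ∀ B, (rankFunction M).IsBase (groundFinset M) B →
        (#(B ∩ F) : ℤ) = rankFunction M F → ℓ' 0 + ∑ x ∈ B, coeff ℓ' x = 0 := by
      intro B hB hBF
      rw [← apply_charVec ℓ' hB]
      exact (hle (show charVec M B ∈ _ from ⟨charVec_mem hB, (hzero B hB).mpr hBF⟩)).2
    obtain ⟨κ, s, hks⟩ := RankFunction.exists_weight_eq (c := coeff ℓ') hFG hsep hl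
      (fun B B' hB hB' h1 h2 => by
        have := hW B hB h1
        have := hW B' hB' h2
        linarith)
    obtain ⟨B₀, hB₀, h1, -⟩ := RankFunction.exists_isBase_inter (r := rankFunction M) (Y := F)
      (Z := F) subset_rfl (union_subset_left hFG)
    have hκ := hW B₀ hB₀ h1
    rw [hks B₀ hB₀] at hκ
    have h1' : ((#(B₀ ∩ F) : ℤ) : ℝ) = rankFunction M F := by rw [h1]
    push_cast at h1'
    rw [h1', sub_self, mul_zero, add_zero] at hκ
    have hval : ∀ B, (rankFunction M).IsBase (groundFinset M) B →
        ℓ' (charVec M B) = s * ℓ (charVec M B) := by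
      intro B hB
      rw [apply_charVec ℓ' hB, hks B hB, hℓ B hB, ← add_assoc, hκ]
      push_cast
      ring
    obtain ⟨B, hB, rfl⟩ := mem_baseConfiguration.mp hv
    rw [hval B hB] at h0
    refine (mul_eq_zero.mp h0).resolve_left fun hs => hneV ?_
    refine Set.ext fun w => ⟨fun hw => hw.1, fun hw => ⟨hw, ?_⟩⟩
    obtain ⟨B, hB, rfl⟩ := mem_baseConfiguration.mp hw
    rw [hval B hB, hs, zero_mul]

/-- The empty set is a proper face, so a facet exists even for a single base. Levelness is therefore
at least 1. -/
theorem not_isKLevel_zero (M : Matroid α) [M.Finite] : ¬ IsKLevel (baseConfiguration M) 0 := by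
  intro hk
  have hfin : {U | IsFace (baseConfiguration M) U ∧ U ≠ baseConfiguration M}.Finite := by
    refine (baseConfiguration_finite M).finite_subsets.subset ?_
    rintro U ⟨⟨ℓ, -, rfl⟩, -⟩
    exact fun x hx => hx.1
  obtain ⟨W, hW⟩ := hfin.exists_maximal ⟨∅, ⟨AffineMap.const ℝ _ 1, by simp, by simp⟩,
    (baseConfiguration_nonempty M).ne_empty.symm⟩
  obtain ⟨⟨ℓ, hnn, rfl⟩, -⟩ := hW.prop
  have := hk ℓ ⟨hnn, hW⟩
  simp only [Nat.cast_zero, nonpos_iff_eq_zero, Set.encard_eq_zero, Set.image_eq_empty] at this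
  exact (baseConfiguration_nonempty M).ne_empty this

theorem lt_level_iff_not_isKLevel [M.Finite] {j : ℕ} :
    j < level M ↔ ¬ IsKLevel (baseConfiguration M) j := by
  have hne : {k : ℕ | IsKLevel (baseConfiguration M) k}.Nonempty := by
    refine ⟨(baseConfiguration M).ncard, fun ℓ _ => ?_⟩
    rw [(baseConfiguration_finite M).cast_ncard_eq]
    exact Set.encard_image_le _ _
  have hmem : IsKLevel (baseConfiguration M) (level M) := Nat.sInf_mem hne
  constructor
  · exact fun h => Nat.notMem_of_lt_sInf h
  · intro h
    by_contra! hle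
    exact h fun ℓ hℓ => (hmem ℓ hℓ).trans (by exact_mod_cast hle)

/-- The levelness of a matroid is at least `j + 1` if and only if some minor has a linked pair of
connectivity at least `j`. -/
theorem lt_level_iff [M.Finite] {j : ℕ} :
    j < level M ↔ ∃ X F G, (rankFunction M).IsLink (groundFinset M) j X F G := by
  rw [lt_level_iff_not_isKLevel]
  rcases Nat.eq_zero_or_pos j with rfl | hj
  · simp only [not_isKLevel_zero, not_false_eq_true, true_iff]
    exact ⟨∅, ∅, ∅, by simp, by simp, by simp, by simp, by simp, Or.inl rfl⟩
  constructor
  · intro h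
    obtain ⟨F, G, hFG, hl⟩ := exists_linked_of_not_isKLevel hj h
    exact ⟨∅, F, G, by simp, union_subset_left hFG, union_subset_right hFG, by simp, by simp,
      Or.inr (by rwa [RankFunction.contract_empty])⟩
  · rintro ⟨X, F, G, h⟩
    obtain ⟨F', G', hFG, -, hsep, hl⟩ := (h.linked.resolve_left hj.ne').exists_component
      (by exact_mod_cast hj) h.contract_subset h.left_subset h.right_subset h.left_disj
      h.right_disj
    exact not_isKLevel_of_linked hj hFG hsep hl

end MatroidLevel

/-! ### Minors and excluded minors -/

namespace MatroidLevel

open Finset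
open scoped Classical

section Minor

variable {α : Type*} {M N : Matroid α} {j : ℕ} {X F G : Finset α}

theorem eRk_contract_add_eRk (M : Matroid α) {A C : Set α} (h : Disjoint A C) :
    (M.contract C).eRk A + M.eRk C = M.eRk (A ∪ C) := by
  obtain ⟨I, hI⟩ := M.exists_isBasis' C
  obtain ⟨J, hJ, hIJ⟩ := hI.indep.subset_isBasis'_of_subset
    (hI.subset.trans (Set.subset_union_right (s := A)))
  have hJC : J ∩ C = I := (hI.eq_of_subset_indep (hJ.indep.inter_right C)
    (Set.subset_inter hIJ hI.subset) Set.inter_subset_right).symm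
  have hA := hJ.contract_isBasis' hI
    (hJ.indep.subset (Set.union_subset Set.sdiff_subset hIJ))
  rw [Set.union_sdiff_right, h.sdiff_eq_left] at hA
  rw [hA.eRk_eq_encard, hI.eRk_eq_encard, hJ.eRk_eq_encard, ← hJC, Set.encard_sdiff_add_encard_inter]

theorem rankFunction_contract_delete (M : Matroid α) {A C : Finset α} {D : Set α}
    (hC : ∀ x ∈ A, x ∉ C) (hD : ∀ x ∈ A, x ∉ D) :
    rankFunction ((M.contract C).delete D) A = (rankFunction M).contract C A := by
  have h := eRk_contract_add_eRk M (A := A) (C := C)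
    (Set.disjoint_left.mpr fun x hx => by simpa using hC x (by simpa using hx))
  have hdel : ((M.contract C).delete D).eRk A = (M.contract C).eRk A := by
    rw [Matroid.delete_eq_restrict, Matroid.restrict_eRk_eq', ← Matroid.eRk_inter_ground _ (A : Set α)]
    congr 1
    ext x
    have := hD x
    simp only [Set.mem_inter_iff, Set.mem_sdiff, mem_coe]
    tauto
  rw [RankFunction.contract_apply, rankFunction_apply, rankFunction_apply, rankFunction_apply,
    hdel, coe_union, ← h, ENat.toNat_add (eRk_coe_ne_top _ A) (eRk_coe_ne_top _ C)]
  push_cast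
  ring

theorem finite_of_isMinor (hM : M.Finite) (h : N ≤m M) : N.Finite :=
  ⟨M.ground_finite.subset h.subset⟩

/-- A link in a minor is a link in the matroid. -/
theorem exists_isLink_of_isMinor [M.Finite] [N.Finite] (h : N ≤m M)
    (hl : (rankFunction N).IsLink (groundFinset N) j X F G) :
    ∃ Y, (rankFunction M).IsLink (groundFinset M) j Y F G := by
  have hsub := h.subset
  obtain ⟨C, D, hC, hD, hCD, rfl⟩ := h.exists_eq_contract_delete_disjoint
  lift C to Finset α using M.ground_finite.subset hC
  obtain ⟨hX, hF, hG, hXF, hXG, hl⟩ := hl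
  have hgr : ∀ {x}, x ∈ groundFinset ((M.contract C).delete D) → x ∈ M.E ∧ x ∉ C ∧ x ∉ D := by
    intro x hx
    rw [mem_groundFinset] at hx
    exact ⟨hx.1.1, by simpa using hx.1.2, hx.2⟩
  have hgr' : ∀ A ⊆ groundFinset ((M.contract C).delete D), A ⊆ groundFinset M :=
    fun A hA x hx => mem_groundFinset.mpr (hgr (hA hx)).1
  have hr : ∀ A ⊆ groundFinset ((M.contract C).delete D),
      rankFunction ((M.contract C).delete D) A = (rankFunction M).contract C A := fun A hA =>
    rankFunction_contract_delete M (fun x hx => (hgr (hA hx)).2.1) fun x hx => (hgr (hA hx)).2.2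
  refine ⟨C ∪ X, union_subset (fun x hx => mem_groundFinset.mpr (hC hx)) (hgr' X hX), hgr' F hF,
    hgr' G hG, ?_, ?_, hl.imp_right fun hl => ?_⟩
  · intro x hx hxF
    exact (mem_union.mp hx).elim (hgr (hF hxF)).2.1 fun h => hXF x h hxF
  · intro x hx hxG
    exact (mem_union.mp hx).elim (hgr (hG hxG)).2.1 fun h => hXG x h hxG
  · rw [← RankFunction.contract_contract]
    refine hl.congr fun A hA => ?_
    have hA' := hA.trans (union_subset hF hG)
    rw [RankFunction.contract_apply, RankFunction.contract_apply, hr _ (union_subset hA' hX),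
      hr X hX]

/-- A link in a matroid spans a minor on the linked sets. -/
theorem exists_isMinor_of_isLink [M.Finite]
    (hl : (rankFunction M).IsLink (groundFinset M) j X F G) :
    ∃ N : Matroid α, N ≤m M ∧ N.E = ((F ∪ G : Finset α) : Set α) ∧ j < level N := by
  obtain ⟨hX, hF, hG, hXF, hXG, hl⟩ := hl
  have hE : ((M.contract X).delete (M.E \ (F ∪ G : Finset α))).E = (F ∪ G : Finset α) := by
    ext x
    have h1 := fun h => mem_groundFinset.mp (@hF x h)
    have h2 := fun h => mem_groundFinset.mp (@hG x h)
    have h3 := hXF x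
    have h4 := hXG x
    simp only [Matroid.delete_ground, Matroid.contract_ground, Set.mem_sdiff, mem_coe, mem_union]
    tauto
  refine ⟨_, Matroid.contract_delete_isMinor M X (M.E \ (F ∪ G : Finset α)), hE,
    lt_level_iff.mpr ⟨∅, F, G, by simp, ?_, ?_, by simp, by simp, hl.imp_right fun hl => ?_⟩⟩
  · exact fun x hx => by rw [mem_groundFinset, hE]; simp [hx]
  · exact fun x hx => by rw [mem_groundFinset, hE]; simp [hx]
  · rw [RankFunction.contract_empty]
    refine hl.congr fun A hA => (rankFunction_contract_delete M ?_ ?_).symm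
    · intro x hx hxX
      exact (mem_union.mp (hA hx)).elim (hXF x hxX) (hXG x hxX)
    · exact fun x hx h => h.2 (hA hx)

theorem level_le_of_isMinor [M.Finite] (h : N ≤m M) : level N ≤ level M := by
  have := finite_of_isMinor ‹M.Finite› h
  by_contra! hlt
  obtain ⟨X, F, G, hl⟩ := lt_level_iff.mp hlt
  obtain ⟨Y, hl'⟩ := exists_isLink_of_isMinor h hl
  exact lt_irrefl _ (lt_level_iff.mpr ⟨Y, F, G, hl'⟩)

/-- A link lives on the minor with ground set `F ∪ G`, so minimality says exactly that every link
covers the ground set. -/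
theorem isExcludedMinor_iff [M.Finite] : IsExcludedMinor (levelClass α j) M ↔
    j < level M ∧ ∀ X F G, (rankFunction M).IsLink (groundFinset M) j X F G →
      F ∪ G = groundFinset M := by
  have hfin : M.Finite := ‹_›
  constructor
  · rintro ⟨-, hM, hmin⟩
    refine ⟨not_le.mp fun h => hM ⟨hfin, h⟩, fun X F G hl => ?_⟩
    obtain ⟨N, hN, hNE, hlt⟩ := exists_isMinor_of_isLink hl
    by_contra! hne
    refine (hmin N (Matroid.isStrictMinor_iff_isMinor_ssubset.mpr ⟨hN,
      hN.subset.ssubset_of_ne fun h => hne ?_⟩)).2.not_gt hlt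
    rwa [hNE, ← coe_groundFinset, coe_inj] at h
  · rintro ⟨hlt, hmin⟩
    refine ⟨hfin, fun h => h.2.not_gt hlt, fun N hN => ?_⟩
    have hNfin := finite_of_isMinor hfin hN.isMinor
    refine ⟨hNfin, not_lt.mp fun hj => ?_⟩
    obtain ⟨X, F, G, hl⟩ := lt_level_iff.mp hj
    obtain ⟨Y, hl'⟩ := exists_isLink_of_isMinor hN.isMinor hl
    refine hN.ssubset.not_subset fun x hx => ?_
    rw [← mem_groundFinset, ← hmin Y F G hl'] at hx
    exact mem_groundFinset.mp (union_subset hl.left_subset hl.right_subset hx)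

theorem groundFinset_eq_empty_of_isExcludedMinor [M.Finite]
    (h : IsExcludedMinor (levelClass α 0) M) : groundFinset M = ∅ := by
  have := (isExcludedMinor_iff.mp h).2 ∅ ∅ ∅
    ⟨by simp, by simp, by simp, by simp, by simp, Or.inl rfl⟩
  simpa using this.symm

/-- Both parameters hold for the same pair: with `i = j + 1` this contradicts `r F = j`, and with `i
= j` it yields the size bounds. -/
theorem exists_minimallyLinked [M.Finite] {i : ℕ} (hij : j ≤ i) (hi : i < level M) (hj : 1 ≤ j)
    (h : IsExcludedMinor (levelClass α j) M) :
    ∃ F G, F ∪ G = groundFinset M ∧ (rankFunction M).MinimallyLinked F G j ∧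
      (rankFunction M).Linked F G i := by
  obtain ⟨hlt, hmin⟩ := isExcludedMinor_iff.mp h
  obtain ⟨X, F, G, hl⟩ := lt_level_iff.mp hi
  have hj' : (rankFunction M).IsLink (groundFinset M) j X F G :=
    { hl with
      linked := Or.inr
        { hl.linked.resolve_left (by omega) with
          le := by
            have := (hl.linked.resolve_left (by omega)).le
            have : (j : ℤ) ≤ i := by exact_mod_cast hij
            linarith } }
  have hFG := hmin X F G hj'
  have hX : X = ∅ := by
    refine eq_empty_of_forall_notMem fun x hx => ?_
    have := hl.contract_subset hx
    rw [← hFG] at this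
    exact (mem_union.mp this).elim (hl.left_disj x hx) (hl.right_disj x hx)
  have hli := hl.linked.resolve_left (by omega)
  have hlj := hj'.linked.resolve_left (by omega)
  rw [hX, RankFunction.contract_empty] at hli hlj
  refine ⟨F, G, hFG, { hlj with
    one_le := by exact_mod_cast hj
    eq_of_linked := fun Y F' G' hY hF' hG' h1 h2 h3 => ?_ }, hli⟩
  rw [hFG] at hY hF' hG' ⊢
  exact hmin Y F' G' ⟨hY, hF', hG', h1, h2, Or.inr h3⟩

theorem level_eq_of_isExcludedMinor [M.Finite] (h : IsExcludedMinor (levelClass α j) M) :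
    level M = j + 1 := by
  refine le_antisymm (not_lt.mp fun hlt => ?_) (isExcludedMinor_iff.mp h).1
  rcases Nat.eq_zero_or_pos j with rfl | hj
  · have hE := groundFinset_eq_empty_of_isExcludedMinor h
    obtain ⟨X, F, G, hl⟩ := lt_level_iff.mp hlt
    obtain ⟨x, hx⟩ := (hl.linked.resolve_left (by omega)).left.1
    have := hl.left_subset hx
    simp [hE] at this
  · obtain ⟨F, G, -, hm, hl⟩ := exists_minimallyLinked (Nat.le_succ j) hlt hj h
    have h1 := hl.le
    have h2 := hm.left_eq
    have h3 := hm.union_eq_right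
    push_cast at h1
    linarith

theorem isExcludedMinor_iff_isMinimallyLevel :
    IsExcludedMinor (levelClass α j) M ↔ IsMinimallyLevel (j + 1) M := by
  constructor
  · intro h
    have := h.1
    have hl := level_eq_of_isExcludedMinor h
    exact ⟨h.1, hl, fun N hN => by have := (h.2.2 N hN).2; omega⟩
  · rintro ⟨h1, h2, h3⟩
    refine ⟨h1, fun h => by have := h.2; omega, fun N hN => ⟨?_, ?_⟩⟩
    · exact finite_of_isMinor h1 hN.isMinor
    · have := h3 N hN
      omega

theorem ncard_ground [M.Finite] : M.E.ncard = #(groundFinset M) := by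
  rw [← coe_groundFinset, Set.ncard_coe_finset]

theorem exists_card_of_isExcludedMinor [M.Finite] (hj : 1 ≤ j)
    (h : IsExcludedMinor (levelClass α j) M) :
    ∃ a b : ℕ, M.E.ncard = a + b ∧ (a = 1 ∨ (j = 2 ∧ a = 3) ∨ a + 2 ≤ 2 * j) ∧
      (b = 1 ∨ (j = 2 ∧ b = 3) ∨ b + 2 ≤ 2 * j) ∧ M.eRank = b := by
  obtain ⟨F, G, hFG, hm, -⟩ := exists_minimallyLinked le_rfl (isExcludedMinor_iff.mp h).1 hj h
  refine ⟨#F, #G, ?_, ?_, ?_, ?_⟩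
  · rw [ncard_ground, ← hFG, card_union_of_disjoint]
    exact disjoint_left.mpr hm.disj
  · have := hm.card_left
    omega
  · have := hm.card_right
    omega
  · have h1 := hm.union_eq_right
    rw [hm.right_eq_card, hFG, rankFunction_eq_iff, coe_groundFinset, M.eRk_ground] at h1
    exact h1

/-- A crude bound valid for all `j`, small cases included; it serves only finiteness. -/
theorem ncard_le_of_isExcludedMinor (h : IsExcludedMinor (levelClass α j) M) :
    M.E.ncard ≤ 4 * j := by
  have := h.1
  rcases Nat.eq_zero_or_pos j with rfl | hj
  · rw [ncard_ground, groundFinset_eq_empty_of_isExcludedMinor h]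
    simp
  · obtain ⟨a, b, h1, h2, h3, -⟩ := exists_card_of_isExcludedMinor hj h
    omega

theorem exists_isExcludedMinor [M.Finite] (h : M ∉ levelClass α j) :
    ∃ N : Matroid α, N ≤m M ∧ IsExcludedMinor (levelClass α j) N := by
  have hM : M.Finite := ‹_›
  obtain ⟨n, hn⟩ : ∃ n, M.E.ncard = n := ⟨_, rfl⟩
  induction n using Nat.strong_induction_on generalizing M with
  | _ n ih =>
    by_cases hmin : ∀ N : Matroid α, N <m M → N ∈ levelClass α j
    · exact ⟨M, Matroid.IsMinor.refl, hM, h, hmin⟩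
    · push Not at hmin
      obtain ⟨N, hN, hNj⟩ := hmin
      have hNfin := finite_of_isMinor hM hN.isMinor
      obtain ⟨N', hN', h'⟩ := ih N.E.ncard
        (hn ▸ Set.ncard_lt_ncard hN.ssubset M.ground_finite) hNj hNfin rfl
      exact ⟨N', hN'.trans hN.isMinor, h'⟩

end Minor

/-! ### Invariance under isomorphism -/

section Map

variable {α β : Type*} {M : Matroid α} {j : ℕ} {f : α → β}

theorem groundFinset_map [M.Finite] (hf : Set.InjOn f M.E) :
    groundFinset (M.map f hf) = (groundFinset M).image f := by
  rw [← coe_inj, coe_groundFinset, coe_image, coe_groundFinset]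
  rfl

theorem rankFunction_map [M.Finite] (hf : Set.InjOn f M.E) {A : Finset α}
    (hA : A ⊆ groundFinset M) : rankFunction (M.map f hf) (A.image f) = rankFunction M A := by
  rw [rankFunction_apply, rankFunction_apply, coe_image,
    M.eRk_map hf (fun x hx => mem_groundFinset.mp (hA hx))]

theorem exists_isLink_of_map [M.Finite] (hf : Set.InjOn f M.E) {X F G : Finset β}
    (h : (rankFunction (M.map f hf)).IsLink (groundFinset (M.map f hf)) j X F G) :
    ∃ X' F' G', (rankFunction M).IsLink (groundFinset M) j X' F' G' ∧ F = F'.image f ∧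
      G = G'.image f := by
  rcases isEmpty_or_nonempty α with hα | hα
  · have hE : groundFinset (M.map f hf) = ∅ := by
      rw [groundFinset_map]
      ext x
      simp
    rw [hE] at h
    have hF := subset_empty.mp h.left_subset
    have hG := subset_empty.mp h.right_subset
    refine ⟨∅, ∅, ∅, ⟨by simp, by simp, by simp, by simp, by simp, h.linked.imp_right fun hl => ?_⟩,
      by simp [hF], by simp [hG]⟩
    have := hl.left.1
    simp [hF] at this
  set g := Function.invFunOn f M.E
  have hgf : ∀ x ∈ M.E, g (f x) = x := fun x hx => hf.leftInvOn_invFunOn hx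
  have hfg : ∀ A ⊆ (groundFinset M).image f, (A.image g).image f = A ∧
      A.image g ⊆ groundFinset M := by
    intro A hA
    obtain ⟨B, hB, rfl⟩ := subset_image_iff.mp hA
    have : (B.image f).image g = B := by
      rw [image_image]
      refine (image_congr fun x hx => ?_).trans image_id
      exact hgf x (mem_groundFinset.mp (hB hx))
    rw [this]
    exact ⟨rfl, hB⟩
  rw [groundFinset_map] at h
  have h' := h.image (q := rankFunction M) (f := g) (fun A hA => ?_) ?_
  · rw [← (show groundFinset M = ((groundFinset M).image f).image g from ?_)] at h'
    · exact ⟨_, _, _, h', (hfg F h.left_subset).1.symm, (hfg G h.right_subset).1.symm⟩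
    · rw [image_image]
      refine (image_id.symm.trans (image_congr fun x hx => ?_))
      exact (hgf x (mem_groundFinset.mp hx)).symm
  · rw [← rankFunction_map hf (hfg A hA).2, (hfg A hA).1]
  · intro x hx y hy hxy
    obtain ⟨a, ha, rfl⟩ := mem_image.mp (mem_coe.mp hx)
    obtain ⟨b, hb, rfl⟩ := mem_image.mp (mem_coe.mp hy)
    rw [hgf a (mem_groundFinset.mp ha), hgf b (mem_groundFinset.mp hb)] at hxy
    rw [hxy]

theorem isLink_map [M.Finite] (hf : Set.InjOn f M.E) {X F G : Finset α}
    (h : (rankFunction M).IsLink (groundFinset M) j X F G) :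
    (rankFunction (M.map f hf)).IsLink (groundFinset (M.map f hf)) j (X.image f) (F.image f)
      (G.image f) := by
  rw [groundFinset_map]
  exact h.image (fun A hA => rankFunction_map hf hA) (by rwa [coe_groundFinset])

theorem lt_level_map_iff [M.Finite] (hf : Set.InjOn f M.E) :
    j < level (M.map f hf) ↔ j < level M := by
  rw [lt_level_iff, lt_level_iff]
  constructor
  · rintro ⟨X, F, G, h⟩
    obtain ⟨X', F', G', h', -⟩ := exists_isLink_of_map hf h
    exact ⟨X', F', G', h'⟩
  · rintro ⟨X, F, G, h⟩
    exact ⟨_, _, _, isLink_map hf h⟩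

theorem IsExcludedMinor.map [M.Finite] (hf : Set.InjOn f M.E)
    (h : IsExcludedMinor (levelClass α j) M) :
    IsExcludedMinor (levelClass β j) (M.map f hf) := by
  rw [isExcludedMinor_iff] at h ⊢
  refine ⟨(lt_level_map_iff hf).mpr h.1, fun X F G hl => ?_⟩
  obtain ⟨X', F', G', hl', rfl, rfl⟩ := exists_isLink_of_map hf hl
  rw [← image_union, h.2 X' F' G' hl', groundFinset_map]

theorem isomorphic_map (hf : Set.InjOn f M.E) : Isomorphic M (M.map f hf) := by
  refine ⟨Equiv.Set.imageOfInjOn f M.E hf, fun B => ?_⟩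
  have : Subtype.val '' (Equiv.Set.imageOfInjOn f M.E hf '' B) = f '' (Subtype.val '' B) := by
    rw [Set.image_image, Set.image_image]
    rfl
  rw [← Matroid.map_image_isBase_iff (hf := hf) (by simp), ← this]
  rfl

theorem Isomorphic.exists_eq_map [Nonempty β] {N : Matroid β} (h : Isomorphic M N) :
    ∃ (f : α → β) (hf : Set.InjOn f M.E), N = M.map f hf := by
  obtain ⟨e, he⟩ := h
  have hval : ∀ x (hx : x ∈ M.E), (if h : x ∈ M.E then (e ⟨x, h⟩ : β) else Classical.arbitrary β) =
      e ⟨x, hx⟩ := fun x hx => dif_pos hx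
  set f : α → β := fun x => if h : x ∈ M.E then (e ⟨x, h⟩ : β) else Classical.arbitrary β
  have hf : Set.InjOn f M.E := by
    intro x hx y hy hxy
    rw [show f x = _ from hval x hx, show f y = _ from hval y hy] at hxy
    simpa using e.injective (Subtype.val_injective hxy)
  have himg : ∀ B : Set M.E, Subtype.val '' (e '' B) = f '' (Subtype.val '' B) := by
    intro B
    rw [Set.image_image, Set.image_image]
    exact Set.image_congr fun x _ => (hval x x.2).symm
  have hE : N.E = f '' M.E := by
    have := himg Set.univ
    simpa using this
  refine ⟨f, hf, Matroid.ext_isBase hE fun B hB => ?_⟩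
  obtain ⟨A, hA, rfl⟩ := Set.subset_image_iff.mp (hB.trans hE.subset)
  obtain ⟨A, rfl⟩ : ∃ A' : Set M.E, Subtype.val '' A' = A :=
    ⟨Subtype.val ⁻¹' A, by simpa using hA⟩
  rw [Matroid.map_image_isBase_iff hA, he, himg]

theorem Isomorphic.lt_level_iff [M.Finite] [Nonempty β] {N : Matroid β} (h : Isomorphic M N) :
    j < level N ↔ j < level M := by
  obtain ⟨f, hf, rfl⟩ := h.exists_eq_map
  exact lt_level_map_iff hf

theorem exists_injOn_range {E : Set α} (hE : E.Finite) {n : ℕ} (hn : E.ncard ≤ n) :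
    ∃ f : α → ℕ, Set.InjOn f E ∧ f '' E ⊆ (range n : Finset ℕ) := by
  obtain ⟨f, hf1, hf2⟩ := (hE.exists_injOn_of_encard_le (t := ((range n : Finset ℕ) : Set ℕ)) (by
    rw [Set.encard_coe_eq_coe_finsetCard, card_range, ← hE.cast_ncard_eq]
    exact_mod_cast hn))
  exact ⟨f, hf2, Set.image_subset_iff.mpr hf1⟩

end Map

end MatroidLevel

/-! ### The main theorem -/

theorem mainTheorem2 (k : ℕ) (hk : 1 ≤ k) :
    -- the excluded minors for the class of `(k-1)`-level matroids are the minimally `k`-level ones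
    (∀ (α : Type u) (M : Matroid α),
      MatroidLevel.IsExcludedMinor (MatroidLevel.levelClass α (k - 1)) M ↔
        MatroidLevel.IsMinimallyLevel k M) ∧
    -- up to isomorphism there are finitely many of them, and they characterize the class
    (∃ L : Set (Matroid ℕ), L.Finite ∧
      (∀ N ∈ L, MatroidLevel.IsExcludedMinor (MatroidLevel.levelClass ℕ (k - 1)) N) ∧
      (∀ (α : Type u) (M : Matroid α),
        MatroidLevel.IsExcludedMinor (MatroidLevel.levelClass α (k - 1)) M →
          ∃ N ∈ L, MatroidLevel.Isomorphic M N) ∧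
      (∀ (α : Type u) (M : Matroid α), M.Finite →
        (M ∈ MatroidLevel.levelClass α (k - 1) ↔
          ∀ M' : Matroid α, M' ≤m M → ∀ N ∈ L, ¬ MatroidLevel.Isomorphic M' N))) ∧
    -- bounds on the number of elements of a minimally `k`-level matroid
    (∀ (α : Type u) (M : Matroid α), MatroidLevel.IsMinimallyLevel k M →
      (k = 3 → M.E.ncard ≤ 6) ∧
      (4 ≤ k → M.E.ncard ≤ 4 * k - 8) ∧
      (4 ≤ k → M.eRank = (k : ℕ∞) → M.E.ncard ≤ 3 * k - 4)) := by
  obtain ⟨j, rfl⟩ : ∃ j, k = j + 1 := ⟨k - 1, by omega⟩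
  rw [Nat.add_sub_cancel]
  have hL : ∀ (α : Type u) (M : Matroid α), MatroidLevel.IsExcludedMinor (MatroidLevel.levelClass α j) M →
      ∃ N : Matroid ℕ, (N.E ⊆ (Finset.range (4 * j) : Finset ℕ) ∧
        MatroidLevel.IsExcludedMinor (MatroidLevel.levelClass ℕ j) N) ∧ MatroidLevel.Isomorphic M N := by
    intro α M h
    have := h.1
    obtain ⟨f, hf, hfE⟩ := MatroidLevel.exists_injOn_range M.ground_finite (MatroidLevel.ncard_le_of_isExcludedMinor h)
    exact ⟨M.map f hf, ⟨hfE, h.map hf⟩, MatroidLevel.isomorphic_map hf⟩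
  refine ⟨fun α M => MatroidLevel.isExcludedMinor_iff_isMinimallyLevel,
    -- All excluded minors on subsets of one finite set large enough to hold a copy of each.
    ⟨{N | N.E ⊆ (Finset.range (4 * j) : Finset ℕ) ∧ MatroidLevel.IsExcludedMinor (MatroidLevel.levelClass ℕ j) N},
      (Matroid.finite_setOfPred_matroid (Finset.finite_toSet _)).subset fun N hN => hN.1,
      fun N hN => hN.2, hL, fun α M hM => ⟨?_, ?_⟩⟩, ?_⟩
  · rintro ⟨-, hlev⟩ M' hM' N hN hiso
    have := MatroidLevel.finite_of_isMinor hM hM'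
    have := hN.2.1
    have h1 := MatroidLevel.level_le_of_isMinor hM'
    have h2 := hiso.lt_level_iff.mp (MatroidLevel.isExcludedMinor_iff.mp hN.2).1
    omega
  · intro h
    by_contra hM'
    obtain ⟨M', hmin, hex⟩ := MatroidLevel.exists_isExcludedMinor hM'
    obtain ⟨N, hN, hiso⟩ := hL α M' hex
    exact h M' hmin N hN hiso
  · intro α M hM
    have := hM.1
    have h := MatroidLevel.isExcludedMinor_iff_isMinimallyLevel.mpr hM
    refine ⟨fun hk => ?_, fun hk => ?_, fun hk hr => ?_⟩ <;>
    -- Here `j = k - 1`: for `j ≥ 3` both parts have at most `2 * j - 2` elements, and `b` is the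
    -- rank, so rank `k` gives `(2 * j - 2) + (j + 1)`. For `j = 2` two triangles give 6.
    · obtain ⟨a, b, h1, h2, h3, h4⟩ := MatroidLevel.exists_card_of_isExcludedMinor (by omega) h
      try rw [h4, Nat.cast_inj] at hr
      omega
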